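/- The function $\beta\mapsto \frac{2(1-\beta)^2}{1+\beta}$ is strictly decreasing on $(-1,1)$. Let $n,m\ge 1$, let $f:\mathbb R^n\times\mathbb R^m\to\mathbb R$ be $C^\infty$, and let $(x^*,y^*)$ be a local Nash equilibrium of $\min_x\max_y f(x,y)$, i.e. $x^*$ is a local minimizer of $f(\cdot,y^*)$ and $y^*$ is a local maximizer of $f(x^*,\cdot)$. With all derivatives taken at $(x^*,y^*)$, put $$\mathcal S=\begin{bmatrix}-\nabla_x^2f&0\\0&\nabla_y^2f\end{bmatrix},\qquad \mathcal A=\begin{bmatrix}0&-\nabla_{xy}f\\ \nabla_{yx}f&0\end{bmatrix},\qquad \mathcal J=\mathcal S+\mathcal A,$$ and let $\mathrm{Sp}(\mathcal J)\subset\mathbb C$ be the set of eigenvalues of $\mathcal J$. Assume that $|\mathrm{Im}\,\lambda|>|\mathrm{Re}\,\lambda|$ for all $\lambda\in\mathrm{Sp}(\mathcal J)$, and that no complex eigenvector of $\mathcal A$ lies in the kernel of $\mathcal S$. For $\beta\in(-1,1)$ and $h>0$, Continuous Sim-HB is the system $$\dot x=-\nabla_x\mathcal F(x,y),\quad \dot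 y=\nabla_y\mathcal F(x,y),\qquad \mathcal F=\frac{1}{1-\beta}f+\frac{h(1+\beta)}{4(1-\beta)^3}\left(\|\nabla_xf\|^2-\|\nabla_yf\|^2\right).$$ It is said to converge locally (to $z^*=(x^*,y^*)$) if there are $\delta,C,c>0$ such that from every $z_0$ with $\|z_0-z^*\|\le\delta$ there starts a solution on $[0,\infty)$, and every such solution satisfies $\|z(t)-z^*\|\le Ce^{-ct}$ for all $t>0$. Let $$H(\beta)=\min_{\lambda\in\mathrm{Sp}(\mathcal J)}\frac{2(1-\beta)^2}{1+\beta}\cdot\frac{|\mathrm{Re}\,\lambda|}{(\mathrm{Im}\,\lambda)^2-(\mathrm{Re}\,\lambda)^2}.$$ Then $H(\beta)>0$ for every $\beta\in(-1,1)$, and Continuous Sim-HB converges locally for all $h\in(0,H(\beta))$. Moreover, a smaller momentum permits a wider range of step sizes: if $-1<\beta_1<\beta_2<1$, then $(0,H(\beta_2))\subsetneq(0,H(\beta_1))$, and the set of all $h>0$ for which Continuous Sim-HB with momentum $\beta_2$ converges locally is a proper subset of the corresponding set for $\beta_1$. -/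

import Mathlib

open scoped ContDiff

noncomputable section

namespace MinMaxHB

/-- The joint strategy space `ℝⁿ × ℝᵐ` of a min-max game, each factor with its Euclidean norm. -/
abbrev Strat (n m : ℕ) : Type := EuclideanSpace ℝ (Fin n) × EuclideanSpace ℝ (Fin m)

variable {n m : ℕ}

/-- `(x*, y*)` is a local Nash equilibrium of `min_x max_y f(x, y)`. -/
def IsLocalNash (f : Strat n m → ℝ) (p : Strat n m) : Prop :=
  IsLocalMin (fun x => f (x, p.2)) p.1 ∧ IsLocalMax (fun y => f (p.1, y)) p.2

/-- The partial gradient `∇ₓ f`. -/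
def gradX (f : Strat n m → ℝ) (p : Strat n m) : EuclideanSpace ℝ (Fin n) :=
  gradient (fun x => f (x, p.2)) p.1

/-- The partial gradient `∇_y f`. -/
def gradY (f : Strat n m → ℝ) (p : Strat n m) : EuclideanSpace ℝ (Fin m) :=
  gradient (fun y => f (p.1, y)) p.2

/-- `∇²ₓ f`, with `(i, j)` entry `∂(∇ₓ f)ᵢ / ∂xⱼ`. -/
def hessXX (f : Strat n m → ℝ) (p : Strat n m) : Matrix (Fin n) (Fin n) ℝ :=
  Matrix.of fun i j =>
    fderiv ℝ (fun x => gradX f (x, p.2)) p.1 (EuclideanSpace.single j 1) i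

/-- `∇_{xy} f`, with `(i, j)` entry `∂(∇ₓ f)ᵢ / ∂yⱼ`. -/
def hessXY (f : Strat n m → ℝ) (p : Strat n m) : Matrix (Fin n) (Fin m) ℝ :=
  Matrix.of fun i j =>
    fderiv ℝ (fun y => gradX f (p.1, y)) p.2 (EuclideanSpace.single j 1) i

/-- `∇_{yx} f`, with `(i, j)` entry `∂(∇_y f)ᵢ / ∂xⱼ`. -/
def hessYX (f : Strat n m → ℝ) (p : Strat n m) : Matrix (Fin m) (Fin n) ℝ :=
  Matrix.of fun i j =>
    fderiv ℝ (fun x => gradY f (x, p.2)) p.1 (EuclideanSpace.single j 1) i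

/-- `∇²_y f`, with `(i, j)` entry `∂(∇_y f)ᵢ / ∂yⱼ`. -/
def hessYY (f : Strat n m → ℝ) (p : Strat n m) : Matrix (Fin m) (Fin m) ℝ :=
  Matrix.of fun i j =>
    fderiv ℝ (fun y => gradY f (p.1, y)) p.2 (EuclideanSpace.single j 1) i

/-- The Jacobian `𝒥` at `p` of the gradient descent-ascent flow `ẋ = -∇ₓ f`, `ẏ = ∇_y f`. -/
def jac (f : Strat n m → ℝ) (p : Strat n m) : Matrix (Fin n ⊕ Fin m) (Fin n ⊕ Fin m) ℝ :=
  Matrix.fromBlocks (-hessXX f p) (-hessXY f p) (hessYX f p) (hessYY f p)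

/-- The potential part `𝒮` of `𝒥`. -/
def potentialPart (f : Strat n m → ℝ) (p : Strat n m) :
    Matrix (Fin n ⊕ Fin m) (Fin n ⊕ Fin m) ℝ :=
  Matrix.fromBlocks (-hessXX f p) 0 0 (hessYY f p)

/-- The Hamiltonian part `𝒜` of `𝒥`. -/
def hamiltonianPart (f : Strat n m → ℝ) (p : Strat n m) :
    Matrix (Fin n ⊕ Fin m) (Fin n ⊕ Fin m) ℝ :=
  Matrix.fromBlocks 0 (-hessXY f p) (hessYX f p) 0

/-- `Sp(M)`: the set of complex eigenvalues of a real square matrix. -/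
def Sp {ι : Type} [Fintype ι] [DecidableEq ι] (M : Matrix ι ι ℝ) : Set ℂ :=
  spectrum ℂ (M.map Complex.ofReal)

/-- `EigVec(M)`: the complex eigenvectors of a real square matrix, together with `0`. -/
def EigVec {ι : Type} [Fintype ι] (M : Matrix ι ι ℝ) : Set (ι → ℂ) :=
  {v | ∃ μ : ℂ, (M.map Complex.ofReal).mulVec v = μ • v}

/-- `Ker(M)`: the complex kernel of a real square matrix. -/
def Ker {ι : Type} [Fintype ι] (M : Matrix ι ι ℝ) : Set (ι → ℂ) :=
  {v | (M.map Complex.ofReal).mulVec v = 0}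

/-- Interaction dominates: `|Im λ| > |Re λ|` for every eigenvalue `λ` of `𝒥`. -/
def InteractionDominates (f : Strat n m → ℝ) (p : Strat n m) : Prop :=
  ∀ l ∈ Sp (jac f p), |l.re| < |l.im|

/-- `EigVec(𝒜) ∩ Ker(𝒮) = {0}`. -/
def EigKerTrivial (f : Strat n m → ℝ) (p : Strat n m) : Prop :=
  EigVec (hamiltonianPart f p) ∩ Ker (potentialPart f p) = {0}

/-- The modified loss `ℱ` for momentum `β` and step size `h`. -/
def modifiedLoss (β h : ℝ) (f : Strat n m → ℝ) (p : Strat n m) : ℝ :=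
  1 / (1 - β) * f p
    + h * (1 + β) / (4 * (1 - β) ^ 3) * (‖gradX f p‖ ^ 2 - ‖gradY f p‖ ^ 2)

/-- The vector field of Continuous Sim-HB: `ẋ = -∇ₓ ℱ(x, y)`, `ẏ = ∇_y ℱ(x, y)`. -/
def simHBField (β h : ℝ) (f : Strat n m → ℝ) (p : Strat n m) : Strat n m :=
  (-gradX (modifiedLoss β h f) p, gradY (modifiedLoss β h f) p)

/-- Local convergence of `ż = V(z)` to the point `p`: from every initial condition close to `p`
there is a solution on `[0, ∞)`, and all such solutions approach `p` at a common exponential rate.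
(Whether the norm on the product is the maximum or the Euclidean one does not matter, as `δ` and
`C` are arbitrary.) -/
def LocallyConverges (V : Strat n m → Strat n m) (p : Strat n m) : Prop :=
  ∃ δ > 0, ∃ C > 0, ∃ c > 0, ∀ z₀ : Strat n m, ‖z₀ - p‖ ≤ δ →
    (∃ z : ℝ → Strat n m, z 0 = z₀ ∧ IsIntegralCurveOn z (fun _ => V) (Set.Ici 0)) ∧
    ∀ z : ℝ → Strat n m, z 0 = z₀ → IsIntegralCurveOn z (fun _ => V) (Set.Ici 0) →
      ∀ t > 0, ‖z t - p‖ ≤ C * Real.exp (-c * t)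

/-- The factor `2(1-β)²/(1+β)`. -/
def momentumFactor (β : ℝ) : ℝ := 2 * (1 - β) ^ 2 / (1 + β)

/-- The step-size bound `min_{λ ∈ Sp(𝒥)} 2(1-β)²/(1+β) · |Re λ| / ((Im λ)² - (Re λ)²)`; the
spectrum is finite and, for `n + m > 0`, nonempty, so the infimum is a minimum. -/
def stepBound (f : Strat n m → ℝ) (p : Strat n m) (β : ℝ) : ℝ :=
  sInf ((fun l : ℂ => momentumFactor β * (|l.re| / (l.im ^ 2 - l.re ^ 2))) '' Sp (jac f p))

/-- The step sizes `h > 0` for which Continuous Sim-HB with momentum `β` converges locally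
to `p`. -/
def convergentSteps (f : Strat n m → ℝ) (p : Strat n m) (β : ℝ) : Set ℝ :=
  {h | 0 < h ∧ LocallyConverges (simHBField β h f) p}

end MinMaxHB

end

/-! Everything reduces to one equivalence: Continuous Sim-HB converges locally exactly when `0 < h <
stepBound`. Let `g = (-∇ₓf, ∇_y f)`. Symmetry of second derivatives turns the Sim-HB field into `a g
- b Dg·g`, with `a = 1/(1-β)` and `b = h(1+β)/(2(1-β)³)` (`simHBField_formula`). Since `g` vanishes
at a Nash point, the linearisation there is `a𝒥 - b𝒥²`, with eigenvalues `aλ - bλ²`. Their real part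
`a Re λ + b((Im λ)² - (Re λ)²)` is negative iff `h` is below the quotient attached to `λ`
(`re_neg_iff`).

This uses `Re λ < 0`. The Nash conditions make `𝒮` negative semidefinite and `𝒜` is antisymmetric,
so `Re λ ≤ 0`; equality would put the eigenvector in the kernel of `𝒮`, making it an eigenvector of
`𝒜`, which is excluded.

Exponential convergence is equivalent to a Hurwitz linearisation, the borderline case included
(`convergesExponentially_iff`). One direction uses a quadratic Lyapunov function. For the other,
given an alleged rate `c` and an eigenvalue with `Re μ ≥ 0`, the linearisation is shifted by some `0
< η < c` to make it hyperbolic and unstable; a quadratic form then forces some solution to decay no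
faster than `e^{-ηt}`.

Hence both strict inclusions amount to `H(β₂) < H(β₁)`, which follows from monotonicity of the
momentum factor because the minimum over the spectrum is attained. -/

namespace MinMaxHB

open Set Filter Topology

/-! ### Stability and instability of equilibria from quadratic forms. -/

section ODE

variable {E : Type*} [NormedAddCommGroup E] [NormedSpace ℝ E]

/-- A bounded, globally Lipschitz autonomous field has solutions on `[0, T]`. -/
theorem exists_solution_Icc [CompleteSpace E] {v : E → E} {K : NNReal} (hv : LipschitzWith K v)
    {M : ℝ} (hM : ∀ x, ‖v x‖ ≤ M) (x₀ : E) {T : ℝ} (hT : 0 ≤ T) :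
    ∃ z : ℝ → E, z 0 = x₀ ∧ ∀ t ∈ Icc 0 T, HasDerivWithinAt z (v (z t)) (Icc 0 T) t := by
  have hM0 : 0 ≤ M := (norm_nonneg _).trans (hM x₀)
  -- Speed at most `M` keeps a curve within `M * T` of `x₀` up to time `T`, so this radius imposes
  -- no restriction on the existence time.
  have h : IsPicardLindelof (fun _ => v) (tmin := 0) (tmax := T) ⟨0, left_mem_Icc.2 hT⟩ x₀
      ⟨M * T, by positivity⟩ 0 ⟨M, hM0⟩ K :=
    { lipschitzOnWith := fun _ _ => hv.lipschitzOnWith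
      continuousOn := fun _ _ => continuousOn_const
      norm_le := fun _ _ x _ => hM x
      mul_max_le := by simp [hT]; exact le_rfl }
  exact h.exists_eq_forall_mem_Icc_hasDerivWithinAt₀

/-- A bounded, globally Lipschitz autonomous field has solutions on `[0, ∞)`. -/
theorem exists_solution_Ici [CompleteSpace E] {v : E → E} {K : NNReal} (hv : LipschitzWith K v)
    {M : ℝ} (hM : ∀ x, ‖v x‖ ≤ M) (x₀ : E) :
    ∃ z : ℝ → E, z 0 = x₀ ∧ IsIntegralCurveOn z (fun _ => v) (Ici 0) := by
  choose z hz0 hz using fun N : ℕ => exists_solution_Icc hv hM x₀ (Nat.cast_nonneg (α := ℝ) N)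
  have hder : ∀ N : ℕ, ∀ t ∈ Ico (0 : ℝ) N, HasDerivWithinAt (z N) (v (z N t)) (Ici t) t := by
    intro N t ht
    refine (hz N t ⟨ht.1, ht.2.le⟩).mono_of_mem_nhdsWithin ?_
    exact mem_of_superset (Icc_mem_nhdsGE ht.2) (Icc_subset_Icc_left ht.1)
  have hcont : ∀ N : ℕ, ContinuousOn (z N) (Icc 0 N) :=
    fun N t ht => (hz N t ht).continuousWithinAt
  have heq : ∀ N N' : ℕ, N ≤ N' → EqOn (z N) (z N') (Icc 0 N) := by
    intro N N' h
    have h' : (N : ℝ) ≤ N' := by exact_mod_cast h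
    refine ODE_solution_unique (v := fun _ => v) (fun _ => hv) (hcont N) (hder N)
      ((hcont N').mono (Icc_subset_Icc_right h'))
      (fun t ht => hder N' t ⟨ht.1, ht.2.trans_le h'⟩) ?_
    rw [hz0, hz0]
  -- By uniqueness the solutions on `[0, N]` are compatible, so reading off the one on `[0, ⌈t⌉]` at
  -- time `t` glues them together.
  have hglue : ∀ N : ℕ, ∀ t ∈ Icc (0 : ℝ) N, z ⌈t⌉₊ t = z N t := by
    intro N t ht
    exact heq _ _ (Nat.ceil_le.2 ht.2) ⟨ht.1, Nat.le_ceil t⟩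
  refine ⟨fun t => z ⌈t⌉₊ t, by simp [hz0], fun t ht => ?_⟩
  obtain ⟨N, hN⟩ := exists_nat_gt t
  have hmem : Icc (0 : ℝ) N ∈ 𝓝[Ici 0] t := by
    rw [← Ici_inter_Iic]
    exact inter_mem self_mem_nhdsWithin (mem_nhdsWithin_of_mem_nhds (Iic_mem_nhds hN))
  have hd := (hz N t ⟨ht, hN.le⟩).mono_of_mem_nhdsWithin hmem
  simp only
  rw [hglue N t ⟨ht, hN.le⟩]
  refine hd.congr_of_eventuallyEq ?_ (hglue N t ⟨ht, hN.le⟩)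
  filter_upwards [hmem] with s hs using hglue N s hs

theorem IsIntegralCurveOn.hasDerivWithinAt_Ici {V : E → E} {z : ℝ → E}
    (hz : IsIntegralCurveOn z (fun _ => V) (Ici 0)) {t : ℝ} (ht : 0 ≤ t) :
    HasDerivWithinAt z (V (z t)) (Ici t) t :=
  (hz t ht).mono (Ici_subset_Ici.2 ht)

/-- Derivative of a quadratic form along a solution. -/
theorem hasDerivWithinAt_quadratic (q : E →L[ℝ] E →L[ℝ] ℝ) (hq : ∀ x y, q x y = q y x)
    {z : ℝ → E} {z' : E} (p : E) {s : Set ℝ} {t : ℝ} (hz : HasDerivWithinAt z z' s t) :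
    HasDerivWithinAt (fun t => q (z t - p) (z t - p)) (2 * q (z t - p) z') s t := by
  have h1 : HasDerivWithinAt (fun t => z t - p) z' s t := hz.sub_const p
  have h2 : HasDerivWithinAt (fun t => q (z t - p)) (q z') s t :=
    q.hasFDerivAt.comp_hasDerivWithinAt t h1
  refine (h2.clm_apply h1).congr_deriv ?_
  rw [hq z']; ring

/-- Near a zero `p` of `V` with derivative `L`, `q (x-p) (V x)` exceeds `q (x-p) (L (x-p))` by at
most `κ‖x-p‖²`. -/
theorem exists_ball_quadratic_le (q : E →L[ℝ] E →L[ℝ] ℝ) {V : E → E} {p : E} {L : E →L[ℝ] E}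
    (hV : HasFDerivAt V L p) (hp : V p = 0) {κ : ℝ} (hκ : 0 < κ) :
    ∃ r > 0, ∀ x, ‖x - p‖ ≤ r →
      q (x - p) (V x) ≤ q (x - p) (L (x - p)) + κ * ‖x - p‖ ^ 2 := by
  -- The `+ 1` covers `q = 0`.
  have hε : 0 < κ / (‖q‖ + 1) := by positivity
  have h := (hasFDerivAt_iff_isLittleO.1 hV).def hε
  obtain ⟨r, hr, hb⟩ := Metric.eventually_nhds_iff.1 h
  refine ⟨r / 2, by positivity, fun x hx => ?_⟩
  have h1 := hb (y := x) (by rw [dist_eq_norm]; linarith)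
  rw [hp, sub_zero] at h1
  have h2 : q (x - p) (V x) = q (x - p) (L (x - p)) + q (x - p) (V x - L (x - p)) := by
    rw [← map_add]; congr 1; abel
  have h3 : q (x - p) (V x - L (x - p)) ≤ ‖q‖ * ‖x - p‖ * ‖V x - L (x - p)‖ :=
    (le_abs_self _).trans (q.le_opNorm₂ _ _)
  have h4 : ‖q‖ * ‖x - p‖ * ‖V x - L (x - p)‖ ≤
      (‖q‖ + 1) * ‖x - p‖ * (κ / (‖q‖ + 1) * ‖x - p‖) := by gcongr; linarith
  have h5 : (‖q‖ + 1) * ‖x - p‖ * (κ / (‖q‖ + 1) * ‖x - p‖) = κ * ‖x - p‖ ^ 2 := by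
    field_simp
  linarith

/-- On a finite-dimensional space a negative definite quadratic form is coercive. -/
theorem exists_quadratic_le [FiniteDimensional ℝ E] (b : E →L[ℝ] E →L[ℝ] ℝ)
    (hb : ∀ x ≠ 0, b x x < 0) : ∃ κ > 0, ∀ x, b x x ≤ -κ * ‖x‖ ^ 2 := by
  rcases subsingleton_or_nontrivial E with h | h
  · exact ⟨1, one_pos, fun x => by simp [Subsingleton.elim x 0]⟩
  have : ProperSpace E := FiniteDimensional.proper_real E
  have hc : ContinuousOn (fun x => b x x) (Metric.sphere (0 : E) 1) :=
    Continuous.continuousOn (by fun_prop)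
  obtain ⟨x₀, hx₀, hmax⟩ := (isCompact_sphere (0 : E) 1).exists_isMaxOn
    (NormedSpace.sphere_nonempty.2 zero_le_one) hc
  have hx₀' : x₀ ≠ 0 := by
    rintro rfl; simp at hx₀
  refine ⟨-b x₀ x₀, by linarith [hb x₀ hx₀'], fun x => ?_⟩
  rcases eq_or_ne x 0 with rfl | hx
  · simp
  have hn : 0 < ‖x‖ := norm_pos_iff.2 hx
  have h1 : b (‖x‖⁻¹ • x) (‖x‖⁻¹ • x) ≤ b x₀ x₀ := by
    refine hmax (a := ‖x‖⁻¹ • x) ?_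
    simp [norm_smul, hn.ne']
  simp only [map_smul, smul_apply, smul_eq_mul] at h1
  rw [← mul_assoc, ← mul_inv, ← sq, inv_mul_le_iff₀ (by positivity)] at h1
  linarith

theorem exists_quadratic_comp_le [FiniteDimensional ℝ E] (q : E →L[ℝ] E →L[ℝ] ℝ) (L : E →L[ℝ] E)
    (h : ∀ x ≠ 0, q x (L x) < 0) : ∃ κ > 0, ∀ x, q x (L x) ≤ -κ * ‖x‖ ^ 2 :=
  exists_quadratic_le (q.bilinearComp (ContinuousLinearMap.id ℝ E) L) h

/-- Cut-off: near a point, a `C¹` field coincides with a bounded, globally Lipschitz one. -/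
theorem exists_lipschitz_bounded_eqOn [FiniteDimensional ℝ E] {V : E → E} (hV : ContDiff ℝ 1 V)
    (p : E) {r : ℝ} (hr : 0 < r) :
    ∃ (v : E → E) (K : NNReal) (M : ℝ), LipschitzWith K v ∧ (∀ x, ‖v x‖ ≤ M) ∧
      ∀ x, ‖x - p‖ ≤ r → v x = V x := by
  have : ProperSpace E := FiniteDimensional.proper_real E
  let χ : ContDiffBump p := ⟨r, r + 1, hr, by linarith⟩
  have hv1 : ContDiff ℝ 1 fun x => χ x • V x := χ.contDiff.smul hV
  have hvs : HasCompactSupport fun x => χ x • V x := χ.hasCompactSupport.smul_right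
  obtain ⟨K, hK⟩ := hv1.lipschitzWith_of_hasCompactSupport hvs one_ne_zero
  obtain ⟨M, hM⟩ := hvs.exists_bound_of_continuous hv1.continuous
  refine ⟨_, K, M, hK, hM, fun x hx => ?_⟩
  have : χ x = 1 := χ.one_of_mem_closedBall (by simpa [dist_eq_norm] using hx)
  simp [this]

/-- Exponential decay inside the region of attraction of a strict quadratic Lyapunov function. -/
theorem quadratic_decay (q : E →L[ℝ] E →L[ℝ] ℝ) (hq : ∀ x y, q x y = q y x)
    {V : E → E} {p : E} {α r c : ℝ}
    (hα : ∀ x, α * ‖x‖ ^ 2 ≤ q x x) (hr : 0 < r) (hc : 0 < c) (hα0 : 0 < α)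
    (hdec : ∀ x, ‖x - p‖ ≤ r → q (x - p) (V x) ≤ -c * q (x - p) (x - p))
    {k : ℝ} (hk : 0 < k) (hkr : k ≤ α * r ^ 2) {z : ℝ → E}
    (hz : IsIntegralCurveOn z (fun _ => V) (Ici 0)) (h0 : q (z 0 - p) (z 0 - p) ≤ k)
    {t : ℝ} (ht : 0 ≤ t) : q (z t - p) (z t - p) ≤ k * Real.exp (-c * t) := by
  have hcz : ContinuousOn z (Icc 0 t) := hz.continuousOn.mono Icc_subset_Ici_self
  -- Barrier argument: derivatives are compared only at times of contact. There `q ≤ k`, so the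
  -- point lies in the ball where `hdec` holds. The derivative of `q` is then at most `-2c q`,
  -- strictly below the barrier's `-c q`.
  refine image_le_of_deriv_right_lt_deriv_boundary'
    (f := fun t => q (z t - p) (z t - p)) (f' := fun t => 2 * q (z t - p) (V (z t)))
    (B := fun t => k * Real.exp (-c * t)) (B' := fun t => k * (Real.exp (-c * t) * (-c)))
    (a := 0) (b := t) ?_ ?_ ?_ ?_ ?_ ?_ ⟨ht, le_rfl⟩
  · exact (q.continuous.comp_continuousOn (hcz.sub continuousOn_const)).clm_apply
      (hcz.sub continuousOn_const)
  · intro s hs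
    exact hasDerivWithinAt_quadratic q hq p (IsIntegralCurveOn.hasDerivWithinAt_Ici hz hs.1)
  · simpa using h0
  · fun_prop
  · intro s _
    have : HasDerivAt (fun t : ℝ => -c * t) (-c) s := by
      simpa using (hasDerivAt_id s).const_mul (-c)
    exact (this.exp.const_mul k).hasDerivWithinAt
  · intro s hs heq
    have he : Real.exp (-c * s) ≤ 1 := Real.exp_le_one_iff.2 (by nlinarith [hs.1])
    have hpos : 0 < k * Real.exp (-c * s) := by positivity
    have hle : ‖z s - p‖ ≤ r := by
      have h1 := hα (z s - p)
      have h2 : α * ‖z s - p‖ ^ 2 ≤ α * r ^ 2 := by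
        rw [heq] at h1; nlinarith
      exact le_of_sq_le_sq (le_of_mul_le_mul_left h2 hα0) hr.le
    have := hdec _ hle
    rw [heq] at this
    nlinarith

/-- Growth estimate for solutions near a zero of a field. -/
theorem norm_sub_le_exp {V : E → E} {p : E} {r K : ℝ}
    (hK : ∀ x, ‖x - p‖ ≤ r → ‖V x‖ ≤ K * ‖x - p‖) {z : ℝ → E}
    (hz : IsIntegralCurveOn z (fun _ => V) (Ici 0)) {ε T : ℝ} (hε : 0 < ε)
    (hK0 : 0 ≤ K) (hT : ε * Real.exp ((K + 1) * T) ≤ r)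
    (h0 : ‖z 0 - p‖ ≤ ε) {t : ℝ} (ht : t ∈ Icc 0 T) : ‖z t - p‖ ≤ r := by
  have hmono : ∀ s ≤ T, ε * Real.exp ((K + 1) * s) ≤ r := fun s hs =>
    le_trans (by gcongr) hT
  have hcz : ContinuousOn z (Icc 0 T) := hz.continuousOn.mono Icc_subset_Ici_self
  -- The rate `K + 1` rather than `K` makes the comparison at contact strict.
  refine (image_norm_le_of_norm_deriv_right_lt_deriv_boundary'
    (f := fun t => z t - p) (f' := fun t => V (z t))
    (B := fun t => ε * Real.exp ((K + 1) * t))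
    (B' := fun t => ε * (Real.exp ((K + 1) * t) * (K + 1)))
    (a := 0) (b := T) ?_ ?_ ?_ ?_ ?_ ?_ ht).trans (hmono t ht.2)
  · exact hcz.sub continuousOn_const
  · intro s hs
    exact (IsIntegralCurveOn.hasDerivWithinAt_Ici hz hs.1).sub_const p
  · simpa using h0
  · fun_prop
  · intro s _
    have : HasDerivAt (fun t : ℝ => (K + 1) * t) (K + 1) s := by
      simpa using (hasDerivAt_id s).const_mul (K + 1)
    exact (this.exp.const_mul ε).hasDerivWithinAt
  · intro s hs heq
    have hpos : 0 < ε * Real.exp ((K + 1) * s) := by positivity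
    have := hK (z s) (heq.le.trans (hmono s hs.2.le))
    rw [heq] at this
    nlinarith

/-- A quadratic form that is negative at the start, and strictly decreasing relative to the rate
`2η`, stays below `-k e^{-2ηt}`. -/
theorem quadratic_le_neg_exp (q : E →L[ℝ] E →L[ℝ] ℝ) (hq : ∀ x y, q x y = q y x)
    {V : E → E} {p : E} {r η : ℝ}
    (hdec : ∀ x, x ≠ p → ‖x - p‖ ≤ r → q (x - p) (V x) < -η * q (x - p) (x - p))
    {k : ℝ} (hk : 0 < k) {z : ℝ → E}
    (hz : IsIntegralCurveOn z (fun _ => V) (Ici 0)) (hzr : ∀ t ≥ 0, ‖z t - p‖ ≤ r)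
    (h0 : q (z 0 - p) (z 0 - p) ≤ -k)
    {t : ℝ} (ht : 0 ≤ t) : q (z t - p) (z t - p) ≤ -k * Real.exp (-(2 * η) * t) := by
  have hcz : ContinuousOn z (Icc 0 t) := hz.continuousOn.mono Icc_subset_Ici_self
  refine image_le_of_deriv_right_lt_deriv_boundary'
    (f := fun t => q (z t - p) (z t - p)) (f' := fun t => 2 * q (z t - p) (V (z t)))
    (B := fun t => -k * Real.exp (-(2 * η) * t))
    (B' := fun t => -k * (Real.exp (-(2 * η) * t) * (-(2 * η))))
    (a := 0) (b := t) ?_ ?_ ?_ ?_ ?_ ?_ ⟨ht, le_rfl⟩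
  · exact (q.continuous.comp_continuousOn (hcz.sub continuousOn_const)).clm_apply
      (hcz.sub continuousOn_const)
  · intro s hs
    exact hasDerivWithinAt_quadratic q hq p (IsIntegralCurveOn.hasDerivWithinAt_Ici hz hs.1)
  · simpa using h0
  · fun_prop
  · intro s _
    have : HasDerivAt (fun t : ℝ => -(2 * η) * t) (-(2 * η)) s := by
      simpa using (hasDerivAt_id s).const_mul (-(2 * η))
    exact (this.exp.const_mul (-k)).hasDerivWithinAt
  · intro s hs heq
    have hpos : 0 < k * Real.exp (-(2 * η) * s) := by positivity
    have hne : z s ≠ p := by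
      intro h
      rw [h] at heq
      simp at heq
      linarith [heq]
    have := hdec _ hne (hzr s hs.1)
    rw [heq] at this
    nlinarith

/-- `LocallyConverges` on an arbitrary normed space. -/
def ConvergesExponentially (V : E → E) (p : E) : Prop :=
  ∃ δ > 0, ∃ C > 0, ∃ c > 0, ∀ z₀ : E, ‖z₀ - p‖ ≤ δ →
    (∃ z : ℝ → E, z 0 = z₀ ∧ IsIntegralCurveOn z (fun _ => V) (Ici 0)) ∧
    ∀ z : ℝ → E, z 0 = z₀ → IsIntegralCurveOn z (fun _ => V) (Ici 0) →
      ∀ t > 0, ‖z t - p‖ ≤ C * Real.exp (-c * t)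

theorem locallyConverges_iff {n m : ℕ} {V : Strat n m → Strat n m} {p : Strat n m} :
    LocallyConverges V p ↔ ConvergesExponentially V p := Iff.rfl

/-- Asymptotic stability from a strict quadratic Lyapunov function of the linearisation. -/
theorem convergesExponentially_of_lyapunov [FiniteDimensional ℝ E] {V : E → E} {p : E}
    (hV : ContDiff ℝ 1 V) (hp : V p = 0) (q : E →L[ℝ] E →L[ℝ] ℝ)
    (hq : ∀ x y, q x y = q y x) (hpos : ∀ x ≠ 0, 0 < q x x)
    (hneg : ∀ x ≠ 0, q x (fderiv ℝ V p x) < 0) : ConvergesExponentially V p := by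
  obtain ⟨α, hα0, hα⟩ := exists_quadratic_le (-q) (fun x hx => by simpa using hpos x hx)
  obtain ⟨κ, hκ0, hκ⟩ := exists_quadratic_comp_le q _ hneg
  replace hα : ∀ x, α * ‖x‖ ^ 2 ≤ q x x := fun x => by
    have := hα x; simp at this; linarith
  obtain ⟨r, hr, hball⟩ := exists_ball_quadratic_le q
    (hV.differentiable one_ne_zero p).hasFDerivAt hp (half_pos hκ0)
  have hqle : ∀ x, q x x ≤ (‖q‖ + 1) * ‖x‖ ^ 2 := fun x => by
    have := (le_abs_self _).trans (q.le_opNorm₂ x x)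
    nlinarith [sq_nonneg ‖x‖]
  have hQ : 0 < ‖q‖ + 1 := by positivity
  -- Half of the coercivity constant `κ` pays for the nonlinear remainder; the other half is
  -- converted into a multiple of `q`.
  set c := κ / 2 / (‖q‖ + 1) with hc
  have hc0 : 0 < c := by positivity
  have hdec : ∀ x, ‖x - p‖ ≤ r → q (x - p) (V x) ≤ -c * q (x - p) (x - p) := by
    intro x hx
    have h1 := hball x hx
    have h2 := hκ (x - p)
    have h3 : c * q (x - p) (x - p) ≤ c * ((‖q‖ + 1) * ‖x - p‖ ^ 2) := by gcongr; exact hqle _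
    have h4 : c * ((‖q‖ + 1) * ‖x - p‖ ^ 2) = κ / 2 * ‖x - p‖ ^ 2 := by rw [hc]; field_simp
    linarith
  -- With this level, `q (x - p) (x - p) ≤ k` implies `‖x - p‖ ≤ r`.
  set k := α * r ^ 2 with hk
  have hk0 : 0 < k := by positivity
  have hinit : ∀ x, ‖x - p‖ ≤ √(k / (‖q‖ + 1)) → q (x - p) (x - p) ≤ k := by
    intro x hx
    have h1 : ‖x - p‖ ^ 2 ≤ k / (‖q‖ + 1) := by
      rw [← Real.sq_sqrt (show 0 ≤ k / (‖q‖ + 1) by positivity)]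
      gcongr
    have h2 := hqle (x - p)
    rw [le_div_iff₀ hQ] at h1
    linarith
  refine ⟨√(k / (‖q‖ + 1)), by positivity, √(k / α), by positivity, c / 2, by positivity,
    fun z₀ hz₀ => ⟨?_, ?_⟩⟩
  · have : CompleteSpace E := FiniteDimensional.complete ℝ E
    -- A solution of the cut-off field exists for all time and, by the decay estimate, never leaves
    -- the ball where that field equals `V`.
    obtain ⟨v, K, M, hK, hM, hvV⟩ := exists_lipschitz_bounded_eqOn hV p hr
    obtain ⟨z, hz0, hz⟩ := exists_solution_Ici hK hM z₀
    refine ⟨z, hz0, fun t ht => ?_⟩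
    have hd := quadratic_decay q hq hα hr hc0 hα0
      (fun x hx => by rw [hvV x hx]; exact hdec x hx) hk0 le_rfl hz
      (by rw [hz0]; exact hinit _ hz₀) ht
    have hle : ‖z t - p‖ ≤ r := by
      have he : Real.exp (-c * t) ≤ 1 := Real.exp_le_one_iff.2 (by
        have : 0 ≤ t := ht
        nlinarith)
      have h2 : α * ‖z t - p‖ ^ 2 ≤ α * r ^ 2 := by
        have := hα (z t - p); nlinarith
      exact le_of_sq_le_sq (le_of_mul_le_mul_left h2 hα0) hr.le
    have := hz t ht
    simpa only [hvV _ hle] using this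
  · intro z hz0 hz t ht
    have hd := quadratic_decay q hq hα hr hc0 hα0 hdec hk0 le_rfl hz
      (by rw [hz0]; exact hinit _ hz₀) ht.le
    have h1 : ‖z t - p‖ ^ 2 ≤ k / α * Real.exp (-c * t) := by
      rw [div_mul_eq_mul_div, le_div_iff₀ hα0]
      linarith [hα (z t - p)]
    refine le_of_sq_le_sq (h1.trans_eq ?_) (by positivity)
    rw [mul_pow, Real.sq_sqrt (by positivity), ← Real.exp_nat_mul]
    congr 2
    push_cast
    ring

/-- If a quadratic form takes negative values and strictly decreases along the linearisation
shifted by arbitrarily small `η > 0`, then there is no local exponential convergence. -/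
theorem not_convergesExponentially_of_chetaev [FiniteDimensional ℝ E] {V : E → E} {p : E}
    (hV : ContDiff ℝ 1 V) (hp : V p = 0)
    (hform : ∀ c : ℝ, 0 < c → ∃ η : ℝ, η < c ∧ ∃ q : E →L[ℝ] E →L[ℝ] ℝ,
      (∀ x y, q x y = q y x) ∧ (∀ x ≠ 0, q x (fderiv ℝ V p x + η • x) < 0) ∧
      ∃ x, q x x < 0) : ¬ ConvergesExponentially V p := by
  rintro ⟨δ, hδ, C, hC, c, hc, hconv⟩
  obtain ⟨η, hηc, q, hq, hneg, x₀, hx₀⟩ := hform c hc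
  obtain ⟨κ, hκ0, hκ⟩ := exists_quadratic_comp_le q
    (fderiv ℝ V p + η • ContinuousLinearMap.id ℝ _) hneg
  replace hκ : ∀ x, q x (fderiv ℝ V p x) + η * q x x ≤ -κ * ‖x‖ ^ 2 := fun x => by
    simpa using hκ x
  have hVd := (hV.differentiable one_ne_zero p).hasFDerivAt
  obtain ⟨r₁, hr₁, hball⟩ := exists_ball_quadratic_le q hVd hp (half_pos hκ0)
  obtain ⟨K, r₂, hr₂, hK0, hK⟩ : ∃ K, ∃ r₂ > 0, 0 ≤ K ∧
      ∀ x, ‖x - p‖ ≤ r₂ → ‖V x‖ ≤ K * ‖x - p‖ := by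
    obtain ⟨K, hK0, hK⟩ := hVd.isBigO_sub.exists_pos
    obtain ⟨r, hr, hb⟩ := Metric.eventually_nhds_iff.1 hK.bound
    refine ⟨K, r / 2, by positivity, hK0.le, fun x hx => ?_⟩
    have := hb (y := x) (by rw [dist_eq_norm]; linarith)
    rwa [hp, sub_zero] at this
  set r := min r₁ r₂
  have hr : 0 < r := lt_min hr₁ hr₂
  have hdec : ∀ x, x ≠ p → ‖x - p‖ ≤ r → q (x - p) (V x) < -η * q (x - p) (x - p) := by
    intro x hxp hx
    have h1 := hball x (hx.trans (min_le_left _ _))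
    have h2 := hκ (x - p)
    have h3 : 0 < κ * ‖x - p‖ ^ 2 :=
      mul_pos hκ0 (pow_pos (norm_pos_iff.2 (sub_ne_zero.2 hxp)) 2)
    linarith
  have hexp : ∀ a : ℝ, 0 < a → Tendsto (fun t : ℝ => Real.exp (-a * t)) atTop (𝓝 0) := by
    intro a ha
    refine Real.tendsto_exp_atBot.comp ?_
    exact tendsto_id.const_mul_atTop_of_neg (by linarith)
  obtain ⟨T, hT⟩ : ∃ T, ∀ t ≥ T, C * Real.exp (-c * t) ≤ r := by
    have h : Tendsto (fun t : ℝ => C * Real.exp (-c * t)) atTop (𝓝 0) := by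
      simpa using (hexp c hc).const_mul C
    exact eventually_atTop.1 (h.eventually (ge_mem_nhds hr))
  -- Small enough that the growth estimate confines the solution to the `r`-ball until `T`; after
  -- `T` the assumed decay does so.
  set ε := min δ (r * Real.exp (-((K + 1) * max T 0)))
  have hε0 : 0 < ε := lt_min hδ (by positivity)
  have hεT : ε * Real.exp ((K + 1) * max T 0) ≤ r := by
    calc ε * Real.exp ((K + 1) * max T 0)
        ≤ r * Real.exp (-((K + 1) * max T 0)) * Real.exp ((K + 1) * max T 0) := by
          gcongr; exact min_le_right _ _
      _ = r := by rw [mul_assoc, ← Real.exp_add]; simp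
  have hx₀n : 0 < ‖x₀‖ := by
    rw [norm_pos_iff]; rintro rfl; simp at hx₀
  set y := (ε / ‖x₀‖) • x₀ with hy
  have hyn : ‖y‖ = ε := by
    rw [hy, norm_smul, Real.norm_of_nonneg (by positivity)]; field_simp
  have hyq : q y y < 0 := by
    simp only [hy, map_smul, smul_apply, smul_eq_mul]
    have : 0 < ε / ‖x₀‖ := by positivity
    exact mul_neg_of_pos_of_neg this (mul_neg_of_pos_of_neg this hx₀)
  obtain ⟨⟨z, hz0, hz⟩, hall⟩ := hconv (p + y) (by
    rw [add_sub_cancel_left, hyn]; exact min_le_left _ _)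
  have hz0' : z 0 - p = y := by rw [hz0]; simp
  have hdecay := hall z hz0 hz
  have hzr : ∀ t ≥ 0, ‖z t - p‖ ≤ r := by
    intro t ht
    rcases le_total t (max T 0) with h | h
    · exact norm_sub_le_exp (fun x hx => hK x (hx.trans (min_le_right _ _))) hz hε0 hK0 hεT
        (by rw [hz0', hyn]) ⟨ht, h⟩
    · rcases ht.lt_or_eq with h0 | rfl
      · exact (hdecay t h0).trans (hT t ((le_max_left _ _).trans h))
      · exact norm_sub_le_exp (fun x hx => hK x (hx.trans (min_le_right _ _))) hz hε0 hK0 hεT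
          (by rw [hz0', hyn]) ⟨le_rfl, le_max_right _ _⟩
  -- `q` stays below `q y y * e^{-2ηt}`, while the assumed convergence gives `|q| ≤ ‖q‖ C²
  -- e^{-2ct}`. As `η < c`, letting `t → ∞` contradicts `q y y < 0`.
  have hmain : ∀ t > 0, -q y y ≤ ‖q‖ * C ^ 2 * Real.exp (-(2 * (c - η)) * t) := by
    intro t ht
    have h1 := quadratic_le_neg_exp q hq hdec (neg_pos.2 hyq) hz hzr (by rw [hz0']; simp) ht.le
    have h2 : -(q (z t - p) (z t - p)) ≤ ‖q‖ * ‖z t - p‖ * ‖z t - p‖ :=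
      (neg_le_abs _).trans (q.le_opNorm₂ _ _)
    have h3 : ‖q‖ * ‖z t - p‖ * ‖z t - p‖ ≤
        ‖q‖ * (C * Real.exp (-c * t)) * (C * Real.exp (-c * t)) := by
      gcongr <;> exact hdecay t ht
    have h4 : -q y y * Real.exp (-(2 * η) * t) ≤
        ‖q‖ * (C * Real.exp (-c * t)) * (C * Real.exp (-c * t)) := by linarith
    have h5 : ‖q‖ * (C * Real.exp (-c * t)) * (C * Real.exp (-c * t)) =
        ‖q‖ * C ^ 2 * Real.exp (-(2 * (c - η)) * t) * Real.exp (-(2 * η) * t) := by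
      have : Real.exp (-(2 * (c - η)) * t) * Real.exp (-(2 * η) * t) =
          Real.exp (-c * t) * Real.exp (-c * t) := by
        rw [← Real.exp_add, ← Real.exp_add]; congr 1; ring
      rw [mul_assoc _ (Real.exp _), this]; ring
    rw [h5] at h4
    exact le_of_mul_le_mul_right h4 (Real.exp_pos _)
  have hlim : Tendsto (fun t : ℝ => ‖q‖ * C ^ 2 * Real.exp (-(2 * (c - η)) * t)) atTop (𝓝 0) := by
    simpa using (hexp (2 * (c - η)) (by linarith)).const_mul (‖q‖ * C ^ 2)
  have := ge_of_tendsto hlim (eventually_gt_atTop 0 |>.mono hmain)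
  linarith

end ODE

end MinMaxHB

/-! ### Lyapunov forms for hyperbolic complex endomorphisms. -/

namespace MinMaxHB

open Module

universe u

/-- Lyapunov's theorem for hyperbolic endomorphisms, in real quadratic form. -/
theorem exists_lyapunov_form (N : ℕ) : ∀ (V : Type u) [NormedAddCommGroup V] [NormedSpace ℂ V]
    [FiniteDimensional ℂ V] (T : V →ₗ[ℂ] V), finrank ℂ V = N →
    (∀ μ : ℂ, End.HasEigenvalue T μ → μ.re ≠ 0) →
    ∃ q : V →L[ℝ] V →L[ℝ] ℝ, (∀ x y, q x y = q y x) ∧ (∀ x ≠ 0, q x (T x) < 0) ∧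
      ((∀ μ : ℂ, End.HasEigenvalue T μ → μ.re < 0) → ∀ x ≠ 0, 0 < q x x) := by
  induction N with
  | zero =>
    intro V _ _ _ T hV _
    have := finrank_zero_iff.1 hV
    exact ⟨0, fun _ _ => rfl, fun x hx => (hx (Subsingleton.elim _ _)).elim,
      fun _ x hx => (hx (Subsingleton.elim _ _)).elim⟩
  | succ N ih =>
    intro V _ _ _ T hV hT
    have : Nontrivial V := nontrivial_of_finrank_pos (R := ℂ) (by omega)
    have : FiniteDimensional ℝ V := FiniteDimensional.complexToReal V
    obtain ⟨μ, hμ⟩ := End.exists_eigenvalue T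
    have hμ0 := hT μ hμ
    -- Any functional `φ` killing the range of `T - μ` is a left eigenvector, so its kernel is an
    -- invariant hyperplane, to which the induction applies.
    have hrange : LinearMap.range (T - algebraMap ℂ (End ℂ V) μ) < ⊤ := by
      rw [lt_top_iff_ne_top]
      intro h
      have hinj := LinearMap.injective_iff_surjective.2 (LinearMap.range_eq_top.1 h)
      obtain ⟨v, hv⟩ := hμ.exists_hasEigenvector
      refine hv.2 (hinj ?_)
      simp [hv.apply_eq_smul]
    obtain ⟨φ, hφ0, hφ⟩ := Submodule.exists_le_ker_of_lt_top _ hrange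
    have hφT : ∀ x, φ (T x) = μ * φ x := by
      intro x
      have : φ (T x - μ • x) = 0 := hφ ⟨x, by simp⟩
      rw [map_sub, map_smul, sub_eq_zero] at this
      simpa using this
    obtain ⟨e, he⟩ : ∃ e, φ e = 1 := LinearMap.surjective hφ0 1
    set W := LinearMap.ker φ with hW
    have hTW : ∀ x ∈ W, T x ∈ W := fun x hx => by
      rw [hW, LinearMap.mem_ker] at hx ⊢; rw [hφT, hx, mul_zero]
    let T' : W →ₗ[ℂ] W := T.restrict hTW
    have heig : ∀ ν, End.HasEigenvalue T' ν → End.HasEigenvalue T ν := by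
      intro ν hν
      obtain ⟨v, hv⟩ := hν.exists_hasEigenvector
      refine End.hasEigenvalue_of_hasEigenvector (x := (v : V)) ⟨?_, ?_⟩
      · rw [End.mem_eigenspace_iff]
        exact congrArg Subtype.val hv.apply_eq_smul
      · simpa using hv.2
    have hfin : finrank ℂ W = N := by
      have : finrank ℂ W + 1 = finrank ℂ V := Module.Dual.finrank_ker_add_one_of_ne_zero hφ0
      omega
    obtain ⟨q', hq's, hq'n, hq'p⟩ := ih W T' hfin (fun ν hν => hT ν (heig ν hν))
    obtain ⟨κ, hκ0, hκ⟩ := exists_quadratic_comp_le q'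
      (LinearMap.toContinuousLinearMap (T'.restrictScalars ℝ)) hq'n
    replace hκ : ∀ x, q' x (T' x) ≤ -κ * ‖x‖ ^ 2 := hκ
    -- the projection onto the hyperplane along `e`
    let π : V →ₗ[ℂ] W := LinearMap.codRestrict W (LinearMap.id - φ.smulRight e) (fun x => by
      simp [hW, he])
    have hπ : ∀ x, (π x : V) = x - φ x • e := fun x => rfl
    have hdecomp : ∀ x, x = φ x • e + π x := fun x => by rw [hπ]; abel
    let πr : V →L[ℝ] W := LinearMap.toContinuousLinearMap (π.restrictScalars ℝ)
    let φr : V →L[ℝ] ℂ := LinearMap.toContinuousLinearMap (φ.restrictScalars ℝ)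
    set w : W := π (T e)
    have hπT : ∀ x, π (T x) = T' (π x) + φ x • w := by
      intro x
      have h1 : π (T (π x)) = T' (π x) := by
        ext
        have : φ (T (π x)) = 0 := hTW _ (π x).2
        rw [hπ, this, zero_smul, sub_zero]
        rfl
      conv_lhs => rw [hdecomp x]
      rw [map_add, map_add, h1, map_smul, map_smul, add_comm]
    -- The sign makes `s‖φ x‖²` decrease along `T`, whether `μ` is stable or not.
    let s : ℝ := if μ.re < 0 then 1 else -1
    have hs : s * μ.re = -|μ.re| := by
      by_cases h : μ.re < 0
      · simp [s, h, abs_of_neg h]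
      · simp [s, h, abs_of_nonneg (not_lt.1 h)]
    let c : ℝ := (‖q'‖ * ‖w‖) ^ 2
    have habs : 0 < |μ.re| := abs_pos.2 hμ0
    -- Large enough to absorb the cross term `q' (π x) (φ x • w)`, which Young's inequality bounds
    -- by `κ/2 ‖π x‖² + c/(2κ) ‖φ x‖²`.
    let K : ℝ := (c / κ + 1) / |μ.re|
    have hK : K * |μ.re| = c / κ + 1 := by simp only [K]; field_simp
    have hc : 0 ≤ c := sq_nonneg _
    have hK0 : 0 < K := by positivity
    let q : V →L[ℝ] V →L[ℝ] ℝ :=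
      (K * s) • ((isBoundedBilinearMap_inner (𝕜 := ℝ) (E := ℂ)).toContinuousLinearMap.bilinearComp φr φr) + q'.bilinearComp πr πr
    have hqa : ∀ x y, q x y = K * s * inner ℝ (φ x) (φ y) + q' (π x) (π y) := by
      intro x y; rfl
    refine ⟨q, fun x y => ?_, fun x hx => ?_, fun hneg x hx => ?_⟩
    · rw [hqa, hqa, hq's, real_inner_comm]
    · rw [hqa, hπT, hφT, map_add]
      have h1 : inner ℝ (φ x) (μ * φ x) = μ.re * ‖φ x‖ ^ 2 := by
        rw [Complex.inner, ← Complex.normSq_eq_norm_sq, Complex.normSq_apply]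
        simp
        ring
      have h2 : q' (π x) (φ x • w) ≤ ‖q'‖ * ‖w‖ * ‖φ x‖ * ‖π x‖ := by
        refine ((le_abs_self _).trans (q'.le_opNorm₂ _ _)).trans_eq ?_
        rw [norm_smul]; ring
      have h3 := hκ (π x)
      have h4 : ‖q'‖ * ‖w‖ * ‖φ x‖ * ‖π x‖ ≤ κ / 2 * ‖π x‖ ^ 2 + c / κ / 2 * ‖φ x‖ ^ 2 := by
        have : 0 ≤ (κ * ‖π x‖ - ‖q'‖ * ‖w‖ * ‖φ x‖) ^ 2 / (2 * κ) := by positivity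
        have e1 : (κ * ‖π x‖ - ‖q'‖ * ‖w‖ * ‖φ x‖) ^ 2 / (2 * κ) =
          κ / 2 * ‖π x‖ ^ 2 + c / κ / 2 * ‖φ x‖ ^ 2 - ‖q'‖ * ‖w‖ * ‖φ x‖ * ‖π x‖ := by
          simp only [c]; field_simp; ring
        linarith
      have h5 : K * s * (μ.re * ‖φ x‖ ^ 2) = -(c / κ + 1) * ‖φ x‖ ^ 2 := by
        rw [← hK]; linear_combination K * ‖φ x‖ ^ 2 * hs
      rw [h1, h5]
      have h6 : 0 ≤ c / κ * ‖φ x‖ ^ 2 := by positivity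
      have h7 : 0 < κ / 2 * ‖π x‖ ^ 2 + ‖φ x‖ ^ 2 := by
        by_cases h : φ x = 0
        · have : π x ≠ 0 := by
            intro h'; apply hx; rw [hdecomp x, h, h']; simp
          have := norm_pos_iff.2 this
          positivity
        · have := norm_pos_iff.2 h
          positivity
      linarith
    · have hμn := hneg μ hμ
      rw [hqa]
      have hs1 : s = 1 := by simp [s, hμn]
      have hq'p := hq'p (fun ν hν => hneg ν (heig ν hν))
      rw [hs1, real_inner_self_eq_norm_sq]
      by_cases h : φ x = 0
      · have : π x ≠ 0 := by
          intro h'; apply hx; rw [hdecomp x, h, h']; simp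
        rw [h]
        simpa using hq'p _ this
      · have h1 := norm_pos_iff.2 h
        have h2 : 0 ≤ q' (π x) (π x) := by
          by_cases h' : π x = 0
          · simp [h']
          · exact (hq'p _ h').le
        have : 0 < K * 1 * ‖φ x‖ ^ 2 := by positivity
        linarith

end MinMaxHB

/-! ### Real matrices, their complex spectrum, and the Hurwitz criterion. -/

namespace MinMaxHB

open Module

section Linear

variable {ι : Type} [Fintype ι]

theorem map_ofReal_mulVec (M : Matrix ι ι ℝ) (v : ι → ℂ) (i : ι) :
    (((M.map Complex.ofReal).mulVec v) i).re = M.mulVec (fun j => (v j).re) i ∧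
    (((M.map Complex.ofReal).mulVec v) i).im = M.mulVec (fun j => (v j).im) i := by
  simp [Matrix.mulVec, dotProduct]

/-- Real and imaginary parts of an eigenvector span an invariant plane. -/
theorem mulVec_re_im_of_eigenvector {M : Matrix ι ι ℝ} {μ : ℂ} {v : ι → ℂ}
    (hv : (M.map Complex.ofReal).mulVec v = μ • v) :
    M.mulVec (fun j => (v j).re) = μ.re • (fun j => (v j).re) - μ.im • (fun j => (v j).im) ∧
    M.mulVec (fun j => (v j).im) = μ.im • (fun j => (v j).re) + μ.re • (fun j => (v j).im) := by
  constructor <;> ext i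
  · rw [← (map_ofReal_mulVec M v i).1, hv]; simp
  · rw [← (map_ofReal_mulVec M v i).2, hv]; simp; ring

variable [DecidableEq ι]

theorem hasEigenvalue_toLin'_iff {M : Matrix ι ι ℝ} {μ : ℂ} :
    End.HasEigenvalue (Matrix.toLin' (M.map Complex.ofReal)) μ ↔ μ ∈ Sp M := by
  rw [End.hasEigenvalue_iff_mem_spectrum, Sp, Matrix.spectrum_toLin']

theorem mem_Sp_iff {M : Matrix ι ι ℝ} {μ : ℂ} :
    μ ∈ Sp M ↔ ∃ v ≠ 0, (M.map Complex.ofReal).mulVec v = μ • v := by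
  rw [← hasEigenvalue_toLin'_iff]
  constructor
  · intro h
    obtain ⟨v, hv⟩ := h.exists_hasEigenvector
    exact ⟨v, hv.2, by simpa using hv.apply_eq_smul⟩
  · rintro ⟨v, hv0, hv⟩
    exact End.hasEigenvalue_of_hasEigenvector
      ⟨End.mem_eigenspace_iff.2 (by simpa using hv), hv0⟩

theorem finite_Sp (M : Matrix ι ι ℝ) : (Sp M).Finite := Matrix.finite_spectrum _

theorem nonempty_Sp [Nonempty ι] (M : Matrix ι ι ℝ) : (Sp M).Nonempty :=
  spectrum.nonempty_of_isAlgClosed_of_finiteDimensional ℂ _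

theorem Sp_polynomial [Nonempty ι] (M : Matrix ι ι ℝ) (a b : ℝ) :
    Sp (a • M - b • (M * M)) = (fun l : ℂ => a * l - b * (l * l)) '' Sp M := by
  have h := spectrum.map_polynomial_aeval_of_nonempty (M.map Complex.ofReal)
    (Polynomial.C (a : ℂ) * Polynomial.X -
      Polynomial.C (b : ℂ) * (Polynomial.X * Polynomial.X)) (nonempty_Sp M)
  have h1 : (a • M - b • (M * M)).map Complex.ofReal =
      Polynomial.aeval (M.map Complex.ofReal) (Polynomial.C (a : ℂ) * Polynomial.X -
      Polynomial.C (b : ℂ) * (Polynomial.X * Polynomial.X)) := by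
    ext i j
    simp [Matrix.mul_apply, Algebra.algebraMap_eq_smul_one]
  rw [Sp, h1, h]
  simp [Sp]

theorem add_mem_Sp_iff {M : Matrix ι ι ℝ} {η : ℝ} {μ : ℂ} :
    μ ∈ Sp (M + η • 1) ↔ μ - η ∈ Sp M := by
  have : (M + η • 1).map Complex.ofReal =
      algebraMap ℂ (Matrix ι ι ℂ) η + M.map Complex.ofReal := by
    ext i j
    by_cases h : i = j <;> simp [h, Matrix.algebraMap_matrix_apply, add_comm]
  rw [Sp, this, Sp, ← spectrum.add_mem_add_iff (s := (η : ℂ)) (r := μ - η), sub_add_cancel]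

variable {E : Type*} [NormedAddCommGroup E] [NormedSpace ℝ E]

/-- A Lyapunov form takes a negative value as soon as there is an unstable eigenvalue. -/
theorem exists_neg_of_eigenvalue (e : E ≃ₗ[ℝ] (ι → ℝ)) {L : E →L[ℝ] E} {M : Matrix ι ι ℝ}
    (hL : ∀ x, e (L x) = M.mulVec (e x)) {q : E →L[ℝ] E →L[ℝ] ℝ} (hs : ∀ x y, q x y = q y x)
    (hn : ∀ x ≠ 0, q x (L x) < 0) {μ : ℂ} (hμ : μ ∈ Sp M) (hpos : 0 < μ.re) :
    ∃ x, q x x < 0 := by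
  obtain ⟨v, hv0, hv⟩ := mem_Sp_iff.1 hμ
  obtain ⟨h1, h2⟩ := mulVec_re_im_of_eigenvector hv
  set a := e.symm (fun j => (v j).re) with ha
  set b := e.symm (fun j => (v j).im) with hb
  have hLa : L a = μ.re • a - μ.im • b := by
    apply e.injective; rw [hL, ha, hb]; simpa using h1
  have hLb : L b = μ.im • a + μ.re • b := by
    apply e.injective; rw [hL, ha, hb]; simpa using h2
  have hle : ∀ x, q x (L x) ≤ 0 := fun x => by
    rcases eq_or_ne x 0 with rfl | hx
    · simp
    · exact (hn x hx).le
  have hlt : q a (L a) + q b (L b) < 0 := by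
    by_cases h : a = 0
    · have hb0 : b ≠ 0 := by
        intro hb0
        apply hv0
        have h3 : (fun j => (v j).re) = 0 := by simpa [ha] using h
        have h4 : (fun j => (v j).im) = 0 := by simpa [hb] using hb0
        ext i
        exact Complex.ext (congrFun h3 i) (congrFun h4 i)
      linarith [hn b hb0, hle a]
    · linarith [hn a h, hle b]
  -- The `μ.im` terms cancel by symmetry of `q`.
  have hsum : q a (L a) + q b (L b) = μ.re * (q a a + q b b) := by
    rw [hLa, hLb]
    simp only [map_sub, map_add, map_smul, smul_eq_mul]
    rw [hs b a]; ring
  rw [hsum] at hlt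
  have : q a a + q b b < 0 := by
    by_contra hcon
    nlinarith [not_lt.1 hcon]
  by_cases h : q a a < 0
  · exact ⟨a, h⟩
  · exact ⟨b, by linarith⟩

variable [FiniteDimensional ℝ E]

theorem exists_real_lyapunov_form (e : E ≃ₗ[ℝ] (ι → ℝ)) {L : E →L[ℝ] E} {M : Matrix ι ι ℝ}
    (hL : ∀ x, e (L x) = M.mulVec (e x)) (hM : ∀ μ ∈ Sp M, μ.re ≠ 0) :
    ∃ q : E →L[ℝ] E →L[ℝ] ℝ, (∀ x y, q x y = q y x) ∧ (∀ x ≠ 0, q x (L x) < 0) ∧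
      ((∀ μ ∈ Sp M, μ.re < 0) → ∀ x ≠ 0, 0 < q x x) := by
  obtain ⟨q, hs, hn, hp⟩ := exists_lyapunov_form _ (ι → ℂ)
    (Matrix.toLin' (M.map Complex.ofReal)) rfl
    (fun μ hμ => hM μ (hasEigenvalue_toLin'_iff.1 hμ))
  let j : E →L[ℝ] (ι → ℂ) := LinearMap.toContinuousLinearMap
    ((LinearMap.compLeft Complex.ofRealCLM.toLinearMap ι).comp e.toLinearMap)
  have hj : ∀ x i, j x i = (e x i : ℂ) := fun _ _ => rfl
  have hj0 : ∀ x ≠ 0, j x ≠ 0 := by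
    intro x hx h
    apply hx
    apply e.injective
    ext i
    have := congrFun h i
    rw [hj] at this
    simpa using this
  have hjL : ∀ x, j (L x) = Matrix.toLin' (M.map Complex.ofReal) (j x) := by
    intro x
    ext i
    rw [hj, hL]
    simp [Matrix.mulVec, dotProduct, hj]
  refine ⟨q.bilinearComp j j, fun x y => hs _ _, fun x hx => ?_, fun h x hx => ?_⟩
  · have := hn (j x) (hj0 x hx)
    rwa [← hjL] at this
  · exact hp (fun μ hμ => h μ (hasEigenvalue_toLin'_iff.1 hμ)) _ (hj0 x hx)

/-- Exponential local convergence to a zero is equivalent to the linearisation being Hurwitz. -/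
theorem convergesExponentially_iff (e : E ≃ₗ[ℝ] (ι → ℝ)) {V : E → E} {p : E} (hV : ContDiff ℝ 1 V)
    (hp : V p = 0) {M : Matrix ι ι ℝ} (hL : ∀ x, e (fderiv ℝ V p x) = M.mulVec (e x)) :
    ConvergesExponentially V p ↔ ∀ μ ∈ Sp M, μ.re < 0 := by
  constructor
  · contrapose!
    rintro ⟨μ, hμ, hμ0⟩
    refine not_convergesExponentially_of_chetaev hV hp fun c hc => ?_
    have hfin : ((fun ν : ℂ => -ν.re) '' Sp M).Finite := (finite_Sp M).image _
    -- Avoiding the finitely many `-ν.re` makes the shifted matrix hyperbolic; `η > 0` makes the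
    -- eigenvalue `μ + η` strictly unstable.
    obtain ⟨η, ⟨hη0, hηc⟩, hη⟩ := (Set.Ioo_infinite hc).exists_notMem_finite hfin
    have hL' : ∀ x, e ((fderiv ℝ V p + η • ContinuousLinearMap.id ℝ E) x) =
        (M + η • 1).mulVec (e x) := by
      intro x
      simp [hL, Matrix.add_mulVec, Matrix.smul_mulVec]
    obtain ⟨q, hs, hn, -⟩ := exists_real_lyapunov_form e hL' (fun ν hν h0 => by
      refine hη ⟨ν - η, add_mem_Sp_iff.1 hν, ?_⟩
      simp [h0])
    refine ⟨η, hηc, q, hs, fun x hx => by simpa using hn x hx, ?_⟩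
    refine exists_neg_of_eigenvalue e hL' hs hn (μ := μ + η)
      (add_mem_Sp_iff.2 (by simpa using hμ)) ?_
    simpa using by linarith
  · intro h
    obtain ⟨q, hs, hn, hpos⟩ := exists_real_lyapunov_form e hL (fun μ hμ => (h μ hμ).ne)
    exact convergesExponentially_of_lyapunov hV hp q hs (hpos h) hn

end Linear

end MinMaxHB

/-! ### The Sim-HB field in terms of the descent-ascent field. -/

namespace MinMaxHB

open InnerProductSpace

variable {n m : ℕ}

/-- The gradient descent-ascent field `(-∇ₓ f, ∇_y f)`. -/
noncomputable def gda (f : Strat n m → ℝ) (z : Strat n m) : Strat n m :=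
  (-gradX f z, gradY f z)

theorem simHBField_eq (β h : ℝ) (f : Strat n m → ℝ) :
    simHBField β h f = gda (modifiedLoss β h f) := rfl

/-- Riesz representation of the first partial of a functional. -/
noncomputable def rieszX : (Strat n m →L[ℝ] ℝ) →L[ℝ] EuclideanSpace ℝ (Fin n) :=
  LinearMap.toContinuousLinearMap
    { toFun := fun l => (toDual ℝ (EuclideanSpace ℝ (Fin n))).symm
        (l.comp (ContinuousLinearMap.inl ℝ _ _))
      map_add' := fun l l' => by rw [ContinuousLinearMap.add_comp, map_add]
      map_smul' := fun c l => by rw [ContinuousLinearMap.smul_comp]; simp }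

/-- Riesz representation of the second partial of a functional. -/
noncomputable def rieszY : (Strat n m →L[ℝ] ℝ) →L[ℝ] EuclideanSpace ℝ (Fin m) :=
  LinearMap.toContinuousLinearMap
    { toFun := fun l => (toDual ℝ (EuclideanSpace ℝ (Fin m))).symm
        (l.comp (ContinuousLinearMap.inr ℝ _ _))
      map_add' := fun l l' => by rw [ContinuousLinearMap.add_comp, map_add]
      map_smul' := fun c l => by rw [ContinuousLinearMap.smul_comp]; simp }

theorem inner_rieszX (l : Strat n m →L[ℝ] ℝ) (u : EuclideanSpace ℝ (Fin n)) :
    inner ℝ (rieszX l) u = l (u, 0) :=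
  toDual_symm_apply (y := l.comp (ContinuousLinearMap.inl ℝ _ _))

theorem inner_rieszY (l : Strat n m →L[ℝ] ℝ) (u : EuclideanSpace ℝ (Fin m)) :
    inner ℝ (rieszY l) u = l (0, u) :=
  toDual_symm_apply (y := l.comp (ContinuousLinearMap.inr ℝ _ _))

theorem rieszX_apply (l : Strat n m →L[ℝ] ℝ) (i : Fin n) :
    rieszX l i = l (EuclideanSpace.single i 1, 0) := by
  rw [← inner_rieszX, EuclideanSpace.inner_single_right]; simp

theorem rieszY_apply (l : Strat n m →L[ℝ] ℝ) (i : Fin m) :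
    rieszY l i = l (0, EuclideanSpace.single i 1) := by
  rw [← inner_rieszY, EuclideanSpace.inner_single_right]; simp

variable {f : Strat n m → ℝ}

theorem hasFDerivAt_pair_left (a : EuclideanSpace ℝ (Fin n)) (b : EuclideanSpace ℝ (Fin m)) :
    HasFDerivAt (fun x : EuclideanSpace ℝ (Fin n) => ((x, b) : Strat n m))
      (ContinuousLinearMap.inl ℝ _ _) a := hasFDerivAt_prodMk_left a b

theorem hasFDerivAt_pair_right (a : EuclideanSpace ℝ (Fin n)) (b : EuclideanSpace ℝ (Fin m)) :
    HasFDerivAt (fun y : EuclideanSpace ℝ (Fin m) => ((a, y) : Strat n m))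
      (ContinuousLinearMap.inr ℝ _ _) b := hasFDerivAt_prodMk_right a b

theorem gradX_eq (hf : Differentiable ℝ f) : gradX f = fun z => rieszX (fderiv ℝ f z) := by
  ext1 z
  have h : HasFDerivAt (fun x => f (x, z.2)) _ z.1 :=
    (hf z).hasFDerivAt.comp z.1 (hasFDerivAt_pair_left z.1 z.2)
  rw [gradX, gradient, h.fderiv]
  rfl

theorem gradY_eq (hf : Differentiable ℝ f) : gradY f = fun z => rieszY (fderiv ℝ f z) := by
  ext1 z
  have h : HasFDerivAt (fun y => f (z.1, y)) _ z.2 :=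
    (hf z).hasFDerivAt.comp z.2 (hasFDerivAt_pair_right z.1 z.2)
  rw [gradY, gradient, h.fderiv]
  rfl

/-- The linear map turning the differential of `f` into the gradient descent-ascent field. -/
noncomputable def rieszGDA : (Strat n m →L[ℝ] ℝ) →L[ℝ] Strat n m := (-rieszX).prod rieszY

theorem gda_eq (hf : Differentiable ℝ f) : gda f = fun z => rieszGDA (fderiv ℝ f z) := by
  ext1 z
  rw [gda, gradX_eq hf, gradY_eq hf]
  rfl

theorem differentiable_fderiv (hf : ContDiff ℝ ∞ f) : Differentiable ℝ (fderiv ℝ f) :=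
  (hf.fderiv_right (m := 1) (WithTop.coe_le_coe.2 le_top)).differentiable one_ne_zero

theorem hasFDerivAt_gradX (hf : ContDiff ℝ ∞ f) (z : Strat n m) :
    HasFDerivAt (gradX f) (rieszX ∘L fderiv ℝ (fderiv ℝ f) z) z := by
  rw [gradX_eq (hf.differentiable (by simp))]
  exact rieszX.hasFDerivAt.comp z (differentiable_fderiv hf z).hasFDerivAt

theorem hasFDerivAt_gradY (hf : ContDiff ℝ ∞ f) (z : Strat n m) :
    HasFDerivAt (gradY f) (rieszY ∘L fderiv ℝ (fderiv ℝ f) z) z := by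
  rw [gradY_eq (hf.differentiable (by simp))]
  exact rieszY.hasFDerivAt.comp z (differentiable_fderiv hf z).hasFDerivAt

theorem hasFDerivAt_gda (hf : ContDiff ℝ ∞ f) (z : Strat n m) :
    HasFDerivAt (gda f) (rieszGDA ∘L fderiv ℝ (fderiv ℝ f) z) z := by
  rw [gda_eq (hf.differentiable (by simp))]
  exact rieszGDA.hasFDerivAt.comp z (differentiable_fderiv hf z).hasFDerivAt

theorem contDiff_gda (hf : ContDiff ℝ ∞ f) : ContDiff ℝ ∞ (gda f) := by
  rw [gda_eq (hf.differentiable (by simp))]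
  exact rieszGDA.contDiff.comp (hf.fderiv_right (by simp))

theorem second_symm (hf : ContDiff ℝ ∞ f) (z u v : Strat n m) :
    fderiv ℝ (fderiv ℝ f) z u v = fderiv ℝ (fderiv ℝ f) z v u :=
  hf.contDiffAt.isSymmSndFDerivAt (by simpa using ENat.LEInfty.out) u v

/-- Differentiating `‖∇ₓf‖² - ‖∇_y f‖²` along `u` gives `2 D²f(u, (∇ₓf, -∇_y f)) = -2 D²f(gda f,
u)`; hence the minus sign and the `4` becoming `2`. -/
theorem hasFDerivAt_modifiedLoss (hf : ContDiff ℝ ∞ f) (β h : ℝ) (z : Strat n m) :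
    HasFDerivAt (modifiedLoss β h f) ((1 / (1 - β)) • fderiv ℝ f z -
      (h * (1 + β) / (2 * (1 - β) ^ 3)) • fderiv ℝ (fderiv ℝ f) z (gda f z)) z := by
  have h1 := ((hf.differentiable (by simp)) z).hasFDerivAt.const_mul (1 / (1 - β))
  have h2 := ((hasFDerivAt_gradX hf z).norm_sq.sub (hasFDerivAt_gradY hf z).norm_sq).const_mul
    (h * (1 + β) / (4 * (1 - β) ^ 3))
  refine (h1.add h2).congr_fderiv ?_
  refine ContinuousLinearMap.ext fun u => ?_
  have hx : inner ℝ (gradX f z) (rieszX (fderiv ℝ (fderiv ℝ f) z u)) =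
      fderiv ℝ (fderiv ℝ f) z u (gradX f z, 0) := by
    rw [real_inner_comm, inner_rieszX]
  have hy : inner ℝ (gradY f z) (rieszY (fderiv ℝ (fderiv ℝ f) z u)) =
      fderiv ℝ (fderiv ℝ f) z u (0, gradY f z) := by
    rw [real_inner_comm, inner_rieszY]
  have hg : fderiv ℝ (fderiv ℝ f) z (gda f z) u =
      -fderiv ℝ (fderiv ℝ f) z u (gradX f z, 0) + fderiv ℝ (fderiv ℝ f) z u (0, gradY f z) := by
    rw [second_symm hf, ← map_neg, ← map_add]
    simp [gda]
  simp only [add_apply, sub_apply, smul_apply, smul_eq_mul, ContinuousLinearMap.comp_apply,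
    innerSL_apply_apply, hx, hy, hg]
  generalize (1 - β) ^ 3 = d
  ring

theorem simHBField_formula (hf : ContDiff ℝ ∞ f) (β h : ℝ) :
    simHBField β h f = fun z => (1 / (1 - β)) • gda f z -
      (h * (1 + β) / (2 * (1 - β) ^ 3)) • fderiv ℝ (gda f) z (gda f z) := by
  have hd : Differentiable ℝ (modifiedLoss β h f) := fun z =>
    (hasFDerivAt_modifiedLoss hf β h z).differentiableAt
  rw [simHBField_eq, gda_eq hd]
  ext1 z
  rw [(hasFDerivAt_modifiedLoss hf β h z).fderiv, (hasFDerivAt_gda hf z).fderiv, map_sub,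
    map_smul, map_smul, gda_eq (hf.differentiable (by simp))]
  rfl

theorem contDiff_simHBField (hf : ContDiff ℝ ∞ f) (β h : ℝ) :
    ContDiff ℝ 1 (simHBField β h f) := by
  rw [simHBField_formula hf]
  have hg := contDiff_gda hf
  have hg1 : ContDiff ℝ 1 (gda f) := hg.of_le (WithTop.coe_le_coe.2 le_top)
  have hg' : ContDiff ℝ 1 (fderiv ℝ (gda f)) := hg.fderiv_right (WithTop.coe_le_coe.2 le_top)
  exact (hg1.const_smul _).sub ((hg'.clm_apply hg1).const_smul _)

/-- The product-rule term containing the second derivative of `g` is evaluated at `g p = 0` and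
drops out. -/
theorem hasFDerivAt_sub_fderiv_apply {E : Type*} [NormedAddCommGroup E] [NormedSpace ℝ E]
    {g : E → E} (hg : ContDiff ℝ ∞ g) {p : E} (hp : g p = 0) (a b : ℝ) :
    HasFDerivAt (fun z => a • g z - b • fderiv ℝ g z (g z))
      (a • fderiv ℝ g p - b • (fderiv ℝ g p ∘L fderiv ℝ g p)) p := by
  have hg1 : HasFDerivAt g (fderiv ℝ g p) p := (hg.differentiable (by simp) p).hasFDerivAt
  have hg' : HasFDerivAt (fderiv ℝ g) (fderiv ℝ (fderiv ℝ g) p) p :=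
    ((hg.fderiv_right (m := 1) (WithTop.coe_le_coe.2 le_top)).differentiable
      one_ne_zero p).hasFDerivAt
  refine ((hg1.const_smul a).sub ((hg'.clm_apply hg1).const_smul b)).congr_fderiv ?_
  simp [hp]

theorem fderiv_simHBField (hf : ContDiff ℝ ∞ f) (β h : ℝ) {p : Strat n m} (hp : gda f p = 0) :
    fderiv ℝ (simHBField β h f) p = (1 / (1 - β)) • fderiv ℝ (gda f) p -
      (h * (1 + β) / (2 * (1 - β) ^ 3)) • (fderiv ℝ (gda f) p ∘L fderiv ℝ (gda f) p) := by
  rw [simHBField_formula hf]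
  exact (hasFDerivAt_sub_fderiv_apply (contDiff_gda hf) hp _ _).fderiv

theorem simHBField_zero (hf : ContDiff ℝ ∞ f) (β h : ℝ) {p : Strat n m} (hp : gda f p = 0) :
    simHBField β h f p = 0 := by
  simp [simHBField_formula hf, hp]

end MinMaxHB

/-! ### Second-order Nash conditions and the spectrum of the Jacobian. -/

namespace MinMaxHB

open InnerProductSpace Filter Topology

variable {n m : ℕ} {f : Strat n m → ℝ} {p : Strat n m}

theorem deriv_deriv_nonneg_of_isLocalMin {φ : ℝ → ℝ} {t : ℝ} (hc : ContinuousAt φ t)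
    (h : IsLocalMin φ t) : 0 ≤ deriv (deriv φ) t := by
  by_contra hneg
  -- A negative second derivative would make `t` a local maximum too, so `φ` would be locally
  -- constant.
  have hmax := isLocalMax_of_deriv_deriv_neg (not_le.1 hneg) h.deriv_eq_zero hc
  have heq : φ =ᶠ[𝓝 t] fun _ => φ t := by
    filter_upwards [h, hmax] with s h1 h2 using le_antisymm h2 h1
  rw [heq.deriv.deriv_eq] at hneg
  simp at hneg

theorem deriv_deriv_nonpos_of_isLocalMax {φ : ℝ → ℝ} {t : ℝ} (hc : ContinuousAt φ t)
    (h : IsLocalMax φ t) : deriv (deriv φ) t ≤ 0 := by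
  have h1 : (fun s => -φ s) = -φ := rfl
  have := deriv_deriv_nonneg_of_isLocalMin hc.neg h.neg
  simpa [h1, deriv.neg'] using this

theorem deriv_deriv_line {E : Type*} [NormedAddCommGroup E] [NormedSpace ℝ E] {g : E → ℝ}
    (hg : Differentiable ℝ g) (hg' : Differentiable ℝ (fderiv ℝ g)) (p w : E) :
    deriv (deriv fun t : ℝ => g (p + t • w)) 0 = fderiv ℝ (fderiv ℝ g) p w w := by
  have hline : ∀ t : ℝ, HasDerivAt (fun t : ℝ => p + t • w) w t := fun t => by
    simpa using ((hasDerivAt_id t).smul_const w).const_add p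
  have h1 : (deriv fun t : ℝ => g (p + t • w)) = fun t => fderiv ℝ g (p + t • w) w := by
    ext t
    exact ((hg _).hasFDerivAt.comp_hasDerivAt t (hline t)).deriv
  rw [h1]
  have h2 : HasFDerivAt (fderiv ℝ g) (fderiv ℝ (fderiv ℝ g) p) (p + (0 : ℝ) • w) := by
    rw [zero_smul, add_zero]
    exact (hg' p).hasFDerivAt
  have h3 : HasDerivAt (fun t : ℝ => fderiv ℝ g (p + t • w)) (fderiv ℝ (fderiv ℝ g) p w) 0 :=
    h2.comp_hasDerivAt 0 (hline 0)
  have h4 : HasDerivAt (fun t : ℝ => fderiv ℝ g (p + t • w) w)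
      (fderiv ℝ (fderiv ℝ g) p w w) 0 := by
    simpa using h3.clm_apply (hasDerivAt_const (0 : ℝ) w)
  exact h4.deriv

theorem continuous_line (hf : ContDiff ℝ ∞ f) (p w : Strat n m) :
    Continuous fun t : ℝ => f (p + t • w) :=
  hf.continuous.comp (by fun_prop)

theorem tendsto_line {E : Type*} [NormedAddCommGroup E] [NormedSpace ℝ E] (a u : E) :
    Tendsto (fun t : ℝ => a + t • u) (𝓝 0) (𝓝 a) := by
  have : Continuous fun t : ℝ => a + t • u := by fun_prop
  simpa using this.tendsto 0

theorem IsLocalNash.second_nonneg (hf : ContDiff ℝ ∞ f) (hp : IsLocalNash f p)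
    (u : EuclideanSpace ℝ (Fin n)) : 0 ≤ fderiv ℝ (fderiv ℝ f) p (u, 0) (u, 0) := by
  rw [← deriv_deriv_line (hf.differentiable (by simp)) (differentiable_fderiv hf)]
  refine deriv_deriv_nonneg_of_isLocalMin (continuous_line hf _ _).continuousAt ?_
  have h := (tendsto_line p.1 u).eventually hp.1
  filter_upwards [h] with t ht
  have e : ∀ s : ℝ, p + s • ((u, 0) : Strat n m) = (p.1 + s • u, p.2) := fun s => by
    ext1 <;> simp
  rw [e, e]
  simpa using ht

theorem IsLocalNash.second_nonpos (hf : ContDiff ℝ ∞ f) (hp : IsLocalNash f p)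
    (u : EuclideanSpace ℝ (Fin m)) : fderiv ℝ (fderiv ℝ f) p (0, u) (0, u) ≤ 0 := by
  rw [← deriv_deriv_line (hf.differentiable (by simp)) (differentiable_fderiv hf)]
  refine deriv_deriv_nonpos_of_isLocalMax (continuous_line hf _ _).continuousAt ?_
  have h := (tendsto_line p.2 u).eventually hp.2
  filter_upwards [h] with t ht
  have e : ∀ s : ℝ, p + s • ((0, u) : Strat n m) = (p.1, p.2 + s • u) := fun s => by
    ext1 <;> simp
  rw [e, e]
  simpa using ht

theorem IsLocalNash.gda_eq_zero (hp : IsLocalNash f p) : gda f p = 0 := by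
  have h1 : gradX f p = 0 := by rw [gradX, gradient, hp.1.fderiv_eq_zero, map_zero]
  have h2 : gradY f p = 0 := by rw [gradY, gradient, hp.2.fderiv_eq_zero, map_zero]
  rw [gda, h1, h2, neg_zero]
  rfl

/-- Coordinates on the joint strategy space. -/
noncomputable def coords : Strat n m ≃ₗ[ℝ] (Fin n ⊕ Fin m → ℝ) where
  toFun z := Sum.elim z.1 z.2
  invFun w := (WithLp.toLp 2 fun i => w (Sum.inl i), WithLp.toLp 2 fun i => w (Sum.inr i))
  map_add' z w := by ext (i | i) <;> simp
  map_smul' c z := by ext (i | i) <;> simp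
  left_inv z := rfl
  right_inv w := by ext (i | i) <;> simp

@[simp] theorem coords_inl (z : Strat n m) (i : Fin n) : coords z (Sum.inl i) = z.1 i := rfl

@[simp] theorem coords_inr (z : Strat n m) (i : Fin m) : coords z (Sum.inr i) = z.2 i := rfl

theorem hessXX_apply (hf : ContDiff ℝ ∞ f) (i j : Fin n) : hessXX f p i j =
    fderiv ℝ (fderiv ℝ f) p (EuclideanSpace.single j 1, 0) (EuclideanSpace.single i 1, 0) := by
  have h : HasFDerivAt (fun x => gradX f (x, p.2)) _ p.1 :=
    HasFDerivAt.comp (g := gradX f) p.1 (hasFDerivAt_gradX hf p)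
      (hasFDerivAt_pair_left p.1 p.2)
  rw [hessXX, Matrix.of_apply, h.fderiv, ← rieszX_apply]
  rfl

theorem hessXY_apply (hf : ContDiff ℝ ∞ f) (i : Fin n) (j : Fin m) : hessXY f p i j =
    fderiv ℝ (fderiv ℝ f) p (0, EuclideanSpace.single j 1) (EuclideanSpace.single i 1, 0) := by
  have h : HasFDerivAt (fun y => gradX f (p.1, y)) _ p.2 :=
    HasFDerivAt.comp (g := gradX f) p.2 (hasFDerivAt_gradX hf p)
      (hasFDerivAt_pair_right p.1 p.2)
  rw [hessXY, Matrix.of_apply, h.fderiv, ← rieszX_apply]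
  rfl

theorem hessYX_apply (hf : ContDiff ℝ ∞ f) (i : Fin m) (j : Fin n) : hessYX f p i j =
    fderiv ℝ (fderiv ℝ f) p (EuclideanSpace.single j 1, 0) (0, EuclideanSpace.single i 1) := by
  have h : HasFDerivAt (fun x => gradY f (x, p.2)) _ p.1 :=
    HasFDerivAt.comp (g := gradY f) p.1 (hasFDerivAt_gradY hf p)
      (hasFDerivAt_pair_left p.1 p.2)
  rw [hessYX, Matrix.of_apply, h.fderiv, ← rieszY_apply]
  rfl

theorem hessYY_apply (hf : ContDiff ℝ ∞ f) (i j : Fin m) : hessYY f p i j =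
    fderiv ℝ (fderiv ℝ f) p (0, EuclideanSpace.single j 1) (0, EuclideanSpace.single i 1) := by
  have h : HasFDerivAt (fun y => gradY f (p.1, y)) _ p.2 :=
    HasFDerivAt.comp (g := gradY f) p.2 (hasFDerivAt_gradY hf p)
      (hasFDerivAt_pair_right p.1 p.2)
  rw [hessYY, Matrix.of_apply, h.fderiv, ← rieszY_apply]
  rfl

theorem euclidean_sum_single {k : ℕ} (x : EuclideanSpace ℝ (Fin k)) :
    x = ∑ j, x j • EuclideanSpace.single j (1 : ℝ) := by
  have := (EuclideanSpace.basisFun (Fin k) ℝ).sum_repr x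
  simpa using this.symm

theorem functional_expand (l : Strat n m →L[ℝ] ℝ) (x : Strat n m) :
    l x = ∑ j, l (EuclideanSpace.single j 1, 0) * x.1 j +
      ∑ j, l (0, EuclideanSpace.single j 1) * x.2 j := by
  have h1 : l (x.1, 0) = ∑ j, l (EuclideanSpace.single j 1, 0) * x.1 j := by
    have : l.comp (ContinuousLinearMap.inl ℝ _ _) x.1 = _ :=
      congrArg _ (euclidean_sum_single x.1)
    rw [map_sum] at this
    simpa [mul_comm] using this
  have h2 : l (0, x.2) = ∑ j, l (0, EuclideanSpace.single j 1) * x.2 j := by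
    have : l.comp (ContinuousLinearMap.inr ℝ _ _) x.2 = _ :=
      congrArg _ (euclidean_sum_single x.2)
    rw [map_sum] at this
    simpa [mul_comm] using this
  rw [← h1, ← h2, ← map_add]
  simp

/-- In coordinates, the derivative of the descent-ascent field is multiplication by `𝒥`. -/
theorem coords_fderiv_gda (hf : ContDiff ℝ ∞ f) (x : Strat n m) :
    coords (fderiv ℝ (gda f) p x) = (jac f p).mulVec (coords x) := by
  rw [(hasFDerivAt_gda hf p).fderiv]
  ext (i | i)
  · have h : coords ((rieszGDA ∘L fderiv ℝ (fderiv ℝ f) p) x) (Sum.inl i) =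
        -fderiv ℝ (fderiv ℝ f) p x (EuclideanSpace.single i 1, 0) := by
      rw [← rieszX_apply]; rfl
    rw [h, second_symm hf, functional_expand]
    simp [jac, Matrix.mulVec, dotProduct, hessXX_apply hf, hessXY_apply hf,
      second_symm hf p _ (EuclideanSpace.single i 1, 0), Finset.sum_neg_distrib]
    ring
  · have h : coords ((rieszGDA ∘L fderiv ℝ (fderiv ℝ f) p) x) (Sum.inr i) =
        fderiv ℝ (fderiv ℝ f) p x (0, EuclideanSpace.single i 1) := by
      rw [← rieszY_apply]; rfl
    rw [h, second_symm hf, functional_expand]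
    simp [jac, Matrix.mulVec, dotProduct, hessYX_apply hf, hessYY_apply hf,
      second_symm hf p _ (0, EuclideanSpace.single i 1)]

theorem dotProduct_coords (x y : Strat n m) :
    coords x ⬝ᵥ coords y = inner ℝ x.1 y.1 + inner ℝ x.2 y.2 := by
  simp [dotProduct, PiLp.inner_apply, mul_comm]

/-- The mixed second derivatives cancel, leaving `-D²f` in the `x` direction plus `D²f` in the `y`
direction, both nonpositive at a Nash point. -/
theorem dotProduct_jac_nonpos (hf : ContDiff ℝ ∞ f) (hp : IsLocalNash f p)
    (a : Fin n ⊕ Fin m → ℝ) : a ⬝ᵥ (jac f p).mulVec a ≤ 0 := by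
  obtain ⟨x, rfl⟩ := coords.surjective a
  rw [← coords_fderiv_gda hf, (hasFDerivAt_gda hf p).fderiv, dotProduct_coords]
  set D := fderiv ℝ (fderiv ℝ f) p with hD
  have h1 : inner ℝ x.1 ((rieszGDA ∘L D) x).1 = -D x (x.1, 0) := by
    rw [← inner_rieszX, real_inner_comm, ← inner_neg_left]; rfl
  have h2 : inner ℝ x.2 ((rieszGDA ∘L D) x).2 = D x (0, x.2) := by
    rw [← inner_rieszY, real_inner_comm]; rfl
  have hx : x = (x.1, 0) + (0, x.2) := by simp
  have h3 : ∀ w, D x w = D (x.1, 0) w + D (0, x.2) w := fun w => by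
    conv_lhs => rw [hx, map_add]
    rfl
  rw [h1, h2, h3, h3, second_symm hf p (0, x.2) (x.1, 0)]
  have h4 := hp.second_nonneg hf x.1
  have h5 := hp.second_nonpos hf x.2
  linarith

theorem potentialPart_isSymm (hf : ContDiff ℝ ∞ f) :
    (potentialPart f p).transpose = potentialPart f p := by
  ext (i | i) (j | j)
  · simp [potentialPart, hessXX_apply hf, second_symm hf p (EuclideanSpace.single i 1, 0)]
  · simp [potentialPart]
  · simp [potentialPart]
  · simp [potentialPart, hessYY_apply hf, second_symm hf p (0, EuclideanSpace.single i 1)]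

theorem hamiltonianPart_transpose (hf : ContDiff ℝ ∞ f) :
    (hamiltonianPart f p).transpose = -hamiltonianPart f p := by
  ext (i | i) (j | j)
  · simp [hamiltonianPart]
  · simp [hamiltonianPart, hessYX_apply hf, hessXY_apply hf,
      second_symm hf p (EuclideanSpace.single i 1, 0)]
  · simp [hamiltonianPart, hessYX_apply hf, hessXY_apply hf,
      second_symm hf p (0, EuclideanSpace.single i 1)]
  · simp [hamiltonianPart]

theorem jac_eq_add : jac f p = potentialPart f p + hamiltonianPart f p := by
  simp [jac, potentialPart, hamiltonianPart, Matrix.fromBlocks_add]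

theorem dotProduct_hamiltonianPart (hf : ContDiff ℝ ∞ f) (a : Fin n ⊕ Fin m → ℝ) :
    a ⬝ᵥ (hamiltonianPart f p).mulVec a = 0 := by
  have h : a ⬝ᵥ (hamiltonianPart f p).mulVec a = -(a ⬝ᵥ (hamiltonianPart f p).mulVec a) := by
    conv_lhs => rw [Matrix.dotProduct_mulVec, ← Matrix.mulVec_transpose,
      hamiltonianPart_transpose hf, Matrix.neg_mulVec, neg_dotProduct, dotProduct_comm]
  linarith

theorem dotProduct_jac_eq (hf : ContDiff ℝ ∞ f) (a : Fin n ⊕ Fin m → ℝ) :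
    a ⬝ᵥ (jac f p).mulVec a = a ⬝ᵥ (potentialPart f p).mulVec a := by
  rw [jac_eq_add, Matrix.add_mulVec, dotProduct_add, dotProduct_hamiltonianPart hf, add_zero]

/-- `𝒜` contributes nothing to the quadratic form, and an isotropic vector of a semidefinite matrix
lies in its kernel. -/
theorem potentialPart_mulVec_eq_zero (hf : ContDiff ℝ ∞ f) (hp : IsLocalNash f p)
    {a : Fin n ⊕ Fin m → ℝ} (ha : a ⬝ᵥ (jac f p).mulVec a = 0) :
    (potentialPart f p).mulVec a = 0 := by
  have hpsd : (-potentialPart f p).PosSemidef := by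
    rw [Matrix.posSemidef_iff_dotProduct_mulVec]
    refine ⟨?_, fun x => ?_⟩
    · rw [Matrix.IsHermitian, Matrix.conjTranspose_eq_transpose_of_trivial, Matrix.transpose_neg,
        potentialPart_isSymm hf]
    · rw [star_trivial, Matrix.neg_mulVec, dotProduct_neg, ← dotProduct_jac_eq hf]
      linarith [dotProduct_jac_nonpos hf hp x]
  have := (hpsd.dotProduct_mulVec_zero_iff a).1 (by
    rw [star_trivial, Matrix.neg_mulVec, dotProduct_neg, ← dotProduct_jac_eq hf, ha, neg_zero])
  simpa [Matrix.neg_mulVec] using this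

theorem re_neg_of_mem_Sp_jac (hf : ContDiff ℝ ∞ f) (hp : IsLocalNash f p)
    (hker : EigKerTrivial f p) {l : ℂ} (hl : l ∈ Sp (jac f p)) : l.re < 0 := by
  obtain ⟨v, hv0, hv⟩ := mem_Sp_iff.1 hl
  obtain ⟨h1, h2⟩ := mulVec_re_im_of_eigenvector hv
  set a : Fin n ⊕ Fin m → ℝ := fun j => (v j).re with ha
  set b : Fin n ⊕ Fin m → ℝ := fun j => (v j).im with hb
  have hsum : a ⬝ᵥ (jac f p).mulVec a + b ⬝ᵥ (jac f p).mulVec b =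
      l.re * (a ⬝ᵥ a + b ⬝ᵥ b) := by
    rw [h1, h2]
    simp only [dotProduct_sub, dotProduct_add, dotProduct_smul, smul_eq_mul]
    rw [dotProduct_comm b a]
    ring
  have hqa := dotProduct_jac_nonpos hf hp a
  have hqb := dotProduct_jac_nonpos hf hp b
  by_contra hre
  have hnn : 0 ≤ l.re * (a ⬝ᵥ a + b ⬝ᵥ b) := by
    have h3 : 0 ≤ a ⬝ᵥ a := Finset.sum_nonneg fun i _ => mul_self_nonneg _
    have h4 : 0 ≤ b ⬝ᵥ b := Finset.sum_nonneg fun i _ => mul_self_nonneg _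
    exact mul_nonneg (not_lt.1 hre) (add_nonneg h3 h4)
  -- If `l.re ≥ 0`, the two nonpositive forms have nonnegative sum, so each vanishes.
  have hSa := potentialPart_mulVec_eq_zero hf hp (a := a) (by linarith)
  have hSb := potentialPart_mulVec_eq_zero hf hp (a := b) (by linarith)
  have hS : ((potentialPart f p).map Complex.ofReal).mulVec v = 0 := by
    ext i
    refine Complex.ext ?_ ?_
    · rw [(map_ofReal_mulVec _ v i).1]; exact congrFun hSa i
    · rw [(map_ofReal_mulVec _ v i).2]; exact congrFun hSb i
  have hA : ((hamiltonianPart f p).map Complex.ofReal).mulVec v = l • v := by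
    have hmap : (jac f p).map Complex.ofReal =
        (potentialPart f p).map Complex.ofReal + (hamiltonianPart f p).map Complex.ofReal := by
      rw [jac_eq_add]
      ext i j
      simp
    rw [hmap, Matrix.add_mulVec, hS, zero_add] at hv
    exact hv
  have : v ∈ EigVec (hamiltonianPart f p) ∩ Ker (potentialPart f p) := ⟨⟨l, hA⟩, hS⟩
  rw [hker] at this
  exact hv0 this

end MinMaxHB

/-! ### Step-size bounds and their dependence on the momentum. -/

namespace MinMaxHB

variable {n m : ℕ} {f : Strat n m → ℝ} {p : Strat n m}

theorem strictAntiOn_momentumFactor : StrictAntiOn momentumFactor (Set.Ioo (-1) 1) := by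
  intro a ha b hb hab
  have h1 : 0 < 1 + a := by linarith [ha.1]
  have h2 : 0 < 1 + b := by linarith [hb.1]
  have h3 : 0 < 1 - b := by linarith [hb.2]
  have h4 : (1 - b) ^ 2 < (1 - a) ^ 2 := by gcongr
  unfold momentumFactor
  gcongr

theorem momentumFactor_pos {β : ℝ} (hβ : β ∈ Set.Ioo (-1 : ℝ) 1) : 0 < momentumFactor β := by
  have h1 : 0 < 1 + β := by linarith [hβ.1]
  have h2 : 0 < 1 - β := by linarith [hβ.2]
  unfold momentumFactor
  positivity

/-- Positive dimension makes the spectrum nonempty; being finite too, it attains its infimum, so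
strict inequalities pass through. -/
theorem lt_stepBound_iff (hn : 0 < n) {β h : ℝ} : h < stepBound f p β ↔
    ∀ l ∈ Sp (jac f p), h < momentumFactor β * (|l.re| / (l.im ^ 2 - l.re ^ 2)) := by
  have : Nonempty (Fin n ⊕ Fin m) := ⟨Sum.inl ⟨0, hn⟩⟩
  rw [stepBound, ((finite_Sp (jac f p)).image _).lt_csInf_iff ((nonempty_Sp (jac f p)).image _)]
  simp only [Set.forall_mem_image]

theorem stepBound_le {β : ℝ} {l : ℂ} (hl : l ∈ Sp (jac f p)) :
    stepBound f p β ≤ momentumFactor β * (|l.re| / (l.im ^ 2 - l.re ^ 2)) :=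
  csInf_le ((finite_Sp (jac f p)).image _).bddBelow ⟨l, hl, rfl⟩

theorem coords_fderiv_simHBField (hf : ContDiff ℝ ∞ f) (hp : IsLocalNash f p) (β h : ℝ)
    (x : Strat n m) : coords (fderiv ℝ (simHBField β h f) p x) =
      ((1 / (1 - β)) • jac f p -
        (h * (1 + β) / (2 * (1 - β) ^ 3)) • (jac f p * jac f p)).mulVec (coords x) := by
  rw [fderiv_simHBField hf β h hp.gda_eq_zero, sub_apply, smul_apply, smul_apply,
    ContinuousLinearMap.comp_apply, map_sub, map_smul, map_smul, coords_fderiv_gda hf,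
    coords_fderiv_gda hf, coords_fderiv_gda hf, Matrix.sub_mulVec, Matrix.smul_mulVec,
    Matrix.smul_mulVec, Matrix.mulVec_mulVec]

/-- The linearised continuous heavy-ball flow is stable along `l` exactly for small steps. -/
theorem re_neg_iff {β : ℝ} (hβ : β ∈ Set.Ioo (-1 : ℝ) 1) (h : ℝ) {l : ℂ} (hre : l.re < 0)
    (him : |l.re| < |l.im|) :
    (((1 / (1 - β) : ℝ) : ℂ) * l - ((h * (1 + β) / (2 * (1 - β) ^ 3) : ℝ) : ℂ) * (l * l)).re < 0 ↔
      h < momentumFactor β * (|l.re| / (l.im ^ 2 - l.re ^ 2)) := by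
  have h1 : 0 < 1 + β := by linarith [hβ.1]
  have h2 : 0 < 1 - β := by linarith [hβ.2]
  have hd : 0 < l.im ^ 2 - l.re ^ 2 := sub_pos.2 (sq_lt_sq.2 him)
  rw [Complex.sub_re, Complex.re_ofReal_mul, Complex.re_ofReal_mul, Complex.mul_re, abs_of_neg hre,
    momentumFactor]
  generalize l.im = y at hd ⊢
  generalize l.re = x at hd ⊢
  have e1 : 1 / (1 - β) * x - h * (1 + β) / (2 * (1 - β) ^ 3) * (x * x - y * y) =
      (h * ((1 + β) * (y ^ 2 - x ^ 2)) - 2 * (1 - β) ^ 2 * -x) / (2 * (1 - β) ^ 3) := by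
    field_simp
    ring
  have e2 : 2 * (1 - β) ^ 2 / (1 + β) * (-x / (y ^ 2 - x ^ 2)) =
      2 * (1 - β) ^ 2 * -x / ((1 + β) * (y ^ 2 - x ^ 2)) := by
    rw [div_mul_div_comm]
  rw [e1, e2, div_lt_iff₀ (by positivity), zero_mul, sub_neg,
    lt_div_iff₀ (mul_pos h1 hd)]

theorem convergentSteps_eq (hn : 0 < n) (hf : ContDiff ℝ ∞ f) (hp : IsLocalNash f p)
    (hdom : InteractionDominates f p) (hker : EigKerTrivial f p) {β : ℝ}
    (hβ : β ∈ Set.Ioo (-1 : ℝ) 1) :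
    convergentSteps f p β = Set.Ioo 0 (stepBound f p β) := by
  have : Nonempty (Fin n ⊕ Fin m) := ⟨Sum.inl ⟨0, hn⟩⟩
  ext h
  refine and_congr_right fun _ => ?_
  rw [locallyConverges_iff, convergesExponentially_iff coords (contDiff_simHBField hf β h)
    (simHBField_zero hf β h hp.gda_eq_zero) (coords_fderiv_simHBField hf hp β h),
    Sp_polynomial, Set.forall_mem_image, lt_stepBound_iff hn]
  exact forall₂_congr fun l hl =>
    re_neg_iff hβ h (re_neg_of_mem_Sp_jac hf hp hker hl) (hdom l hl)

theorem ratio_pos (hf : ContDiff ℝ ∞ f) (hp : IsLocalNash f p)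
    (hdom : InteractionDominates f p) (hker : EigKerTrivial f p) {l : ℂ}
    (hl : l ∈ Sp (jac f p)) : 0 < |l.re| / (l.im ^ 2 - l.re ^ 2) :=
  div_pos (abs_pos.2 (re_neg_of_mem_Sp_jac hf hp hker hl).ne)
    (sub_pos.2 (sq_lt_sq.2 (hdom l hl)))

theorem stepBound_pos (hn : 0 < n) (hf : ContDiff ℝ ∞ f) (hp : IsLocalNash f p)
    (hdom : InteractionDominates f p) (hker : EigKerTrivial f p) {β : ℝ}
    (hβ : β ∈ Set.Ioo (-1 : ℝ) 1) : 0 < stepBound f p β :=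
  (lt_stepBound_iff hn).2 fun _ hl =>
    mul_pos (momentumFactor_pos hβ) (ratio_pos hf hp hdom hker hl)

theorem stepBound_lt_stepBound (hn : 0 < n) (hf : ContDiff ℝ ∞ f) (hp : IsLocalNash f p)
    (hdom : InteractionDominates f p) (hker : EigKerTrivial f p) {β₁ β₂ : ℝ}
    (h₁ : β₁ ∈ Set.Ioo (-1 : ℝ) 1) (h₂ : β₂ ∈ Set.Ioo (-1 : ℝ) 1) (h : β₁ < β₂) :
    stepBound f p β₂ < stepBound f p β₁ :=
  (lt_stepBound_iff hn).2 fun _ hl => (stepBound_le hl).trans_lt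
    (mul_lt_mul_of_pos_right (strictAntiOn_momentumFactor h₁ h₂ h)
      (ratio_pos hf hp hdom hker hl))

end MinMaxHB

theorem corollary4p7 :
    StrictAntiOn MinMaxHB.momentumFactor (Set.Ioo (-1) 1) ∧
    ∀ (n m : ℕ), 0 < n → 0 < m →
      ∀ (f : MinMaxHB.Strat n m → ℝ) (p : MinMaxHB.Strat n m),
        ContDiff ℝ ∞ f → MinMaxHB.IsLocalNash f p →
        MinMaxHB.InteractionDominates f p → MinMaxHB.EigKerTrivial f p →
        (∀ β ∈ Set.Ioo (-1 : ℝ) 1,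
          0 < MinMaxHB.stepBound f p β ∧
          Set.Ioo 0 (MinMaxHB.stepBound f p β) ⊆ MinMaxHB.convergentSteps f p β) ∧
        (∀ β₁ ∈ Set.Ioo (-1 : ℝ) 1, ∀ β₂ ∈ Set.Ioo (-1 : ℝ) 1, β₁ < β₂ →
          Set.Ioo 0 (MinMaxHB.stepBound f p β₂) ⊂ Set.Ioo 0 (MinMaxHB.stepBound f p β₁) ∧
          MinMaxHB.convergentSteps f p β₂ ⊂ MinMaxHB.convergentSteps f p β₁) := by
  refine ⟨MinMaxHB.strictAntiOn_momentumFactor, fun n m hn _ f p hf hp hdom hker => ⟨?_, ?_⟩⟩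
  · intro β hβ
    exact ⟨MinMaxHB.stepBound_pos hn hf hp hdom hker hβ,
      (MinMaxHB.convergentSteps_eq hn hf hp hdom hker hβ).ge⟩
  · intro β₁ h₁ β₂ h₂ h
    rw [MinMaxHB.convergentSteps_eq hn hf hp hdom hker h₁,
      MinMaxHB.convergentSteps_eq hn hf hp hdom hker h₂, and_self]
    have hlt := MinMaxHB.stepBound_lt_stepBound hn hf hp hdom hker h₁ h₂ h
    -- The step size separating the two intervals is `stepBound f p β₂` itself.
    exact (Set.ssubset_iff_of_subset (Set.Ioo_subset_Ioo_right hlt.le)).2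
      ⟨_, ⟨MinMaxHB.stepBound_pos hn hf hp hdom hker h₂, hlt⟩, fun h' => lt_irrefl _ h'.2⟩
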